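/- **Setting.** Let $G$ be a directed graph (loops and multiple edges allowed) with source and target maps $\mathbf d,\mathbf r\colon G_1\to G_0$, in which every vertex has finite in-degree at least $2$. Here the in-degree of $v$ is the number of edges $e$ with $\mathbf r(e)=v$. A finite path is a sequence of edges $x_1\cdots x_n$ with $\mathbf d(x_i)=\mathbf r(x_{i+1})$, including an empty path $1_v$ at each vertex $v$. The set of finite paths, with concatenation, is the free category $G^*$. The path $xz$ is defined when $\mathbf d(x)=\mathbf r(z)$, and $|x|$ denotes the length of $x$. $G^\omega$ is the set of right-infinite paths $w_1w_2w_3\cdots$ with $\mathbf d(w_i)=\mathbf r(w_{i+1})$. Its topology is generated by the sets $xG^\omega$ of infinite paths with prefix $x\in G^*$. Write $x^{-1}w=w'$ if $w=xw'$. **The Cuntz–Krieger semigroup.** The graph inverse semigroup $P_G$ consists of $0$ and the symbols $xy^{-1}$ with $x,y\in G^*$ and $\mathbf d(x)=\mathbf d(y)$. The product $xy^{-1}\cdot uv^{-1}$ equals $(xz)v^{-1}$ if $u=yz$, equals $x(vz)^{-1}$ if $y=uz$, and is $0$ otherwise. Also $(xy^{-1})^{-1}=yx^{-1}$. Its natural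 partial order has $0$ as least element, and $xy^{-1}\le uv^{-1}$ iff $x=up$, $y=vp$ for some $p\in G^*$. Elements $s,t$ are orthogonal if $s^{-1}t=0=st^{-1}$. Let $D(P_G)$ be the set of finite subsets of $P_G$ that contain $0$ and whose distinct elements are pairwise orthogonal, with multiplication of subsets. For $a\in P_G$ and $B\in D(P_G)$ write $a\to B$ if for every $0\ne x\le a$ there is $b\in B$ such that $x\wedge b\neq 0$. Write $A\equiv B$ if $a\to B$ for all $a\in A$ and $b\to A$ for all $b\in B$. This is a congruence on $D(P_G)$. Put $CK_G=D(P_G)/{\equiv}$ and let $\delta\colon P_G\to CK_G$ be $\delta(s)=[\{0,s\}]$. **The groupoid.** Let $\mathcal G$ be the set of triples $(w,k,w')\in G^\omega\times\mathbb Z\times G^\omega$ for which there are finite paths $u,v$ with $u^{-1}w=v^{-1}w'$ and $|v|-|u|=k$. It is a groupoid under $(w,k,w')(w',l,w'')=(w,k+l,w'')$ and $(w,k,w')^{-1}=(w',-k,w)$, with set of objects $G^\omega$. For $x,y\in G^*$ let $Z(x,y)$ be the set of $(w,k,w')\in\mathcal G$ with $x^{-1}w=y^{-1}w'$ and $k=|y|-|x|$.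 Give $\mathcal G$ the topology generated by the sets $Z(x,y)$. **Theorem 3.20.** The sets $Z(x,y)$ form a basis of the topology of $\mathcal G$. With this topology, and with the topology above on its space of objects $G^\omega$, $\mathcal G$ is an étale Hausdorff topological groupoid. The semigroup $CK_G$ and the ample semigroup of $\mathcal G$ are inverse semigroups. Here the ample semigroup is the set of compact-open bisections of $\mathcal G$, i.e. compact open sets on which $(w,k,w')\mapsto w$ and $(w,k,w')\mapsto w'$ are both injective, under multiplication of subsets. There is an isomorphism of semigroups from $CK_G$ onto the ample semigroup of $\mathcal G$ that maps $\delta(xy^{-1})$ to $Z(x,y)$ for all $x,y\in G^*$ with $\mathbf d(x)=\mathbf d(y)$. -/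

import Mathlib

open Set CategoryTheory Topology

namespace GraphCK

universe u v

/-! ## Directed graphs, finite paths, right-infinite paths -/

/-- A directed graph with vertex set `V` and edge set `E` (loops and multiple edges are allowed):
every edge `e` has a domain (source) `d e` and a range (target) `r e`. -/
structure DirectedGraph (V : Type u) (E : Type v) where
  d : E → V
  r : E → V

/-- `G.IsPath w l`: the list of edges `l = x₁ x₂ … xₙ` is a path `← ← … ←` with target `w`, that is,
`r x₁ = w` and `d xᵢ = r xᵢ₊₁`. The empty list is the empty path at `w`. -/
def DirectedGraph.IsPath {V : Type u} {E : Type v} (G : DirectedGraph V E) : V → List E → Prop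
  | _, [] => True
  | w, e :: l => G.r e = w ∧ G.IsPath (G.d e) l

/-- The source of the path with target `w` and edges `l`. -/
def DirectedGraph.source {V : Type u} {E : Type v} (G : DirectedGraph V E) : V → List E → V
  | w, [] => w
  | _, e :: l => G.source (G.d e) l

/-- Finite paths in `G`, i.e. the arrows of the free category `G*`. -/
@[ext]
structure FinPath {V : Type u} {E : Type v} (G : DirectedGraph V E) where
  /-- the target of the path -/
  r : V
  /-- the list of edges -/
  edges : List E
  isPath : G.IsPath r edges

/-- The domain (source vertex) of a finite path. -/
def FinPath.d {V : Type u} {E : Type v} {G : DirectedGraph V E} (x : FinPath G) : V :=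
  G.source x.r x.edges

/-- The length `|x|` of a finite path. -/
def FinPath.length {V : Type u} {E : Type v} {G : DirectedGraph V E} (x : FinPath G) : ℕ :=
  x.edges.length

theorem isPath_append {V : Type u} {E : Type v} (G : DirectedGraph V E) (l m : List E) (w : V) :
    G.IsPath w (l ++ m) ↔ G.IsPath w l ∧ G.IsPath (G.source w l) m := by
  induction l generalizing w with
  | nil => simp [DirectedGraph.IsPath, DirectedGraph.source]
  | cons e l ih => simp [DirectedGraph.IsPath, DirectedGraph.source, ih, and_assoc]

theorem source_append {V : Type u} {E : Type v} (G : DirectedGraph V E) (l m : List E) (w : V) :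
    G.source w (l ++ m) = G.source (G.source w l) m := by
  induction l generalizing w with
  | nil => rfl
  | cons e l ih => simp [DirectedGraph.source, ih]

/-- The composite `xz` in the free category, defined when `d x = r z`: first the edges of `x`,
then those of `z`. -/
def FinPath.comp {V : Type u} {E : Type v} {G : DirectedGraph V E} (x z : FinPath G)
    (h : x.d = z.r) : FinPath G where
  r := x.r
  edges := x.edges ++ z.edges
  isPath := (isPath_append G _ _ _).2 ⟨x.isPath, by
    have := z.isPath
    rwa [← h] at this⟩

theorem FinPath.comp_d {V : Type u} {E : Type v} {G : DirectedGraph V E} (x z : FinPath G)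
    (h : x.d = z.r) : (x.comp z h).d = z.d := by
  have h' : G.source x.r x.edges = z.r := h
  simp only [FinPath.d, FinPath.comp, source_append, h']

theorem FinPath.comp_assoc {V : Type u} {E : Type v} {G : DirectedGraph V E} (x y z : FinPath G)
    (h : x.d = y.r) (h' : (x.comp y h).d = z.r) :
    (x.comp y h).comp z h' = x.comp (y.comp z ((x.comp_d y h).symm.trans h')) h := by
  ext1
  · rfl
  · simp [FinPath.comp]

theorem FinPath.comp_left_cancel {V : Type u} {E : Type v} {G : DirectedGraph V E}
    {x z z' : FinPath G} {h : x.d = z.r} {h' : x.d = z'.r} (e : x.comp z h = x.comp z' h') :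
    z = z' := by
  ext1
  · exact h.symm.trans h'
  · exact List.append_cancel_left (congrArg FinPath.edges e)

theorem FinPath.comp_right_cancel {V : Type u} {E : Type v} {G : DirectedGraph V E}
    {x x' z : FinPath G} {h : x.d = z.r} {h' : x'.d = z.r} (e : x.comp z h = x'.comp z h') :
    x = x' := by
  ext1
  · have hr := congrArg FinPath.r e
    exact hr
  · exact List.append_cancel_right (congrArg FinPath.edges e)

/-- Two finite paths with a common extension are prefix-comparable. -/
theorem FinPath.comparable {V : Type u} {E : Type v} {G : DirectedGraph V E} {x y p q : FinPath G}
    {h : x.d = p.r} {h' : y.d = q.r} (e : x.comp p h = y.comp q h') :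
    (∃ z, ∃ hz : x.d = z.r, ∃ hz' : z.d = q.r, y = x.comp z hz ∧ p = z.comp q hz') ∨
    (∃ z, ∃ hz : y.d = z.r, ∃ hz' : z.d = p.r, x = y.comp z hz ∧ q = z.comp p hz') := by
  have key : ∀ {x y p q : FinPath G} {h : x.d = p.r} {h' : y.d = q.r}
      (_ : x.comp p h = y.comp q h') (z : List E) (_ : y.edges = x.edges ++ z),
      ∃ z, ∃ hz : x.d = z.r, ∃ hz' : z.d = q.r, y = x.comp z hz ∧ p = z.comp q hz' := by
    intro x y p q h h' e z hz
    have hr : x.r = y.r := by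
      have := congrArg FinPath.r e
      exact this
    have hp : G.IsPath x.d z := by
      have := y.isPath
      rw [hz, ← hr, isPath_append] at this
      exact this.2
    have hy : y = x.comp ⟨x.d, z, hp⟩ rfl := by
      ext1
      · exact hr.symm
      · exact hz
    refine ⟨⟨x.d, z, hp⟩, rfl, ?_, hy, ?_⟩
    · have := FinPath.comp_d x ⟨x.d, z, hp⟩ rfl
      rw [← this, ← hy, h']
    · refine FinPath.comp_left_cancel (x := x) (h := h) (h' := rfl) ?_
      rw [e]
      ext1
      · exact hr.symm
      · simp [FinPath.comp, hz]
  have he : x.edges ++ p.edges = y.edges ++ q.edges := congrArg FinPath.edges e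
  rcases List.append_eq_append_iff.1 he with ⟨z, hz, -⟩ | ⟨z, hz, -⟩
  · exact Or.inl (key e z hz)
  · exact Or.inr (key e.symm z hz)

/-- Right-infinite paths `w₀ w₁ w₂ …`, with `d wₙ = r wₙ₊₁`: the set `G^ω`. -/
@[ext]
structure InfPath {V : Type u} {E : Type v} (G : DirectedGraph V E) where
  edges : Stream' E
  isPath : ∀ n, G.d (edges.get n) = G.r (edges.get (n + 1))

/-- The target of an infinite path. -/
def InfPath.r {V : Type u} {E : Type v} {G : DirectedGraph V E} (w : InfPath G) : V :=
  G.r (w.edges.get 0)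

theorem append_isPath {V : Type u} {E : Type v} (G : DirectedGraph V E) (s : Stream' E)
    (hs : ∀ n, G.d (s.get n) = G.r (s.get (n + 1))) (l : List E) (w : V) (hl : G.IsPath w l)
    (h : G.source w l = G.r (s.get 0)) :
    G.r ((l ++ₛ s).get 0) = w ∧
      ∀ n, G.d ((l ++ₛ s).get n) = G.r ((l ++ₛ s).get (n + 1)) := by
  induction l generalizing w with
  | nil => exact ⟨h.symm, hs⟩
  | cons e l ih =>
    obtain ⟨h1, h2⟩ := ih (G.d e) hl.2 h
    refine ⟨hl.1, fun n => ?_⟩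
    cases n with
    | zero => exact h1.symm
    | succ n => exact h2 n

/-- The infinite path `xw` obtained by putting the finite path `x` in front of the infinite path
`w`, defined when `d x = r w`. So `x⁻¹w = w'` means `w = xw'`. -/
def FinPath.prepend {V : Type u} {E : Type v} {G : DirectedGraph V E} (x : FinPath G)
    (w : InfPath G) (h : x.d = w.r) : InfPath G where
  edges := x.edges ++ₛ w.edges
  isPath := (append_isPath G w.edges w.isPath x.edges x.r x.isPath h).2

theorem FinPath.prepend_r {V : Type u} {E : Type v} {G : DirectedGraph V E} (x : FinPath G)
    (w : InfPath G) (h : x.d = w.r) : (x.prepend w h).r = x.r :=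
  (append_isPath G w.edges w.isPath x.edges x.r x.isPath h).1

theorem FinPath.comp_prepend {V : Type u} {E : Type v} {G : DirectedGraph V E} (x z : FinPath G)
    (w : InfPath G) (h : x.d = z.r) (h' : z.d = w.r) :
    (x.comp z h).prepend w ((x.comp_d z h).trans h') =
      x.prepend (z.prepend w h') (h.trans (z.prepend_r w h').symm) := by
  ext1
  exact Stream'.append_append_stream _ _ _

/-- Two finite prefixes of one infinite path are prefix-comparable. -/
theorem FinPath.prepend_comparable {V : Type u} {E : Type v} {G : DirectedGraph V E}
    {x y : FinPath G} {w w' : InfPath G} {h : x.d = w.r} {h' : y.d = w'.r}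
    (e : x.prepend w h = y.prepend w' h') :
    (∃ z, ∃ hz : x.d = z.r, ∃ hz' : z.d = w'.r, y = x.comp z hz ∧ w = z.prepend w' hz') ∨
    (∃ z, ∃ hz : y.d = z.r, ∃ hz' : z.d = w.r, x = y.comp z hz ∧ w' = z.prepend w hz') := by
  have cancel : ∀ (l : List E) (s t : Stream' E), l ++ₛ s = l ++ₛ t → s = t := by
    intro l s t hst
    rw [← Stream'.drop_append_stream l s, hst, Stream'.drop_append_stream]
  have key : ∀ {x y : FinPath G} {w w' : InfPath G} {h : x.d = w.r} {h' : y.d = w'.r}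
      (_ : x.prepend w h = y.prepend w' h') (_ : x.edges.length ≤ y.edges.length),
      ∃ z, ∃ hz : x.d = z.r, ∃ hz' : z.d = w'.r, y = x.comp z hz ∧ w = z.prepend w' hz' := by
    intro x y w w' h h' e hle
    have hr : x.r = y.r := by rw [← x.prepend_r w h, e, y.prepend_r]
    have he : x.edges ++ₛ w.edges = y.edges ++ₛ w'.edges := congrArg InfPath.edges e
    have hpre : ∀ (l m : List E) (s t : Stream' E), l ++ₛ s = m ++ₛ t → l.length ≤ m.length →
        ∃ z, m = l ++ z := by
      intro l
      induction l with
      | nil => intro m s t _ _; exact ⟨m, rfl⟩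
      | cons a l ih =>
        intro m s t hst hlm
        cases m with
        | nil => simp at hlm
        | cons b m =>
          have h0 : a = b := congrArg Stream'.head hst
          have h1 : l ++ₛ s = m ++ₛ t := congrArg Stream'.tail hst
          obtain ⟨z, hz⟩ := ih m s t h1 (by simpa using hlm)
          exact ⟨z, by rw [h0, hz]; rfl⟩
    obtain ⟨z, hz⟩ := hpre _ _ _ _ he hle
    have hp : G.IsPath x.d z := by
      have := y.isPath
      rw [hz, ← hr, isPath_append] at this
      exact this.2
    have hy : y = x.comp ⟨x.d, z, hp⟩ rfl := by
      ext1
      · exact hr.symm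
      · exact hz
    refine ⟨⟨x.d, z, hp⟩, rfl, ?_, hy, ?_⟩
    · have := FinPath.comp_d x ⟨x.d, z, hp⟩ rfl
      rw [← this, ← hy, h']
    · ext1
      refine cancel x.edges _ _ ?_
      rw [he, hz, Stream'.append_append_stream]
      rfl
  rcases le_total x.edges.length y.edges.length with hle | hle
  · exact Or.inl (key e hle)
  · exact Or.inr (key e.symm hle)

/-- The cylinder set `xG^ω` of all infinite paths with prefix `x`. -/
def cylinder {V : Type u} {E : Type v} {G : DirectedGraph V E} (x : FinPath G) :
    Set (InfPath G) :=
  {w | ∃ w' : InfPath G, ∃ h : x.d = w'.r, w = x.prepend w' h}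

/-- The usual topology on `G^ω`, generated by the cylinder sets. -/
instance InfPath.instTopologicalSpace {V : Type u} {E : Type v} (G : DirectedGraph V E) :
    TopologicalSpace (InfPath G) :=
  TopologicalSpace.generateFrom (range cylinder)

/-! ## The graph inverse semigroup -/

/-- The graph inverse semigroup `P_G`: its elements are a zero and the fractions `xy⁻¹`, for finite
paths `x` and `y` with the same domain. -/
inductive GraphInvSemigroup {V : Type u} {E : Type v} (G : DirectedGraph V E) : Type (max u v)
  | zero : GraphInvSemigroup G
  | frac (x y : FinPath G) (h : x.d = y.d) : GraphInvSemigroup G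

namespace GraphInvSemigroup

instance {V : Type u} {E : Type v} (G : DirectedGraph V E) : Zero (GraphInvSemigroup G) := ⟨zero⟩

/-- `(xy⁻¹)⁻¹ = yx⁻¹` and `0⁻¹ = 0`. -/
instance {V : Type u} {E : Type v} (G : DirectedGraph V E) : Inv (GraphInvSemigroup G) where
  inv
    | zero => zero
    | frac x y h => frac y x h.symm

open Classical in
/-- The product: `xy⁻¹ · uv⁻¹` is `xz v⁻¹` if `u = yz`, it is `x (vz)⁻¹` if `y = uz`,
and it is `0` otherwise. -/
noncomputable instance {V : Type u} {E : Type v} (G : DirectedGraph V E) :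
    Mul (GraphInvSemigroup G) where
  mul
    | frac x y h, frac u v h' =>
      if H : ∃ z : FinPath G, ∃ hz : y.d = z.r, u = y.comp z hz then
        frac (x.comp H.choose (h.trans H.choose_spec.choose)) v
          ((FinPath.comp_d _ _ _).trans ((FinPath.comp_d _ _ _).symm.trans
            ((congrArg FinPath.d H.choose_spec.choose_spec).symm.trans h')))
      else if H : ∃ z : FinPath G, ∃ hz : u.d = z.r, y = u.comp z hz then
        frac x (v.comp H.choose (h'.symm.trans H.choose_spec.choose))
          (h.trans ((congrArg FinPath.d H.choose_spec.choose_spec).trans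
            ((FinPath.comp_d _ _ _).trans (FinPath.comp_d _ _ _).symm)))
      else zero
    | _, _ => zero

/-- The natural partial order: `0` is the least element, and `xy⁻¹ ≤ uv⁻¹` iff `x = up` and `y = vp`
for some path `p`. -/
instance {V : Type u} {E : Type v} (G : DirectedGraph V E) : LE (GraphInvSemigroup G) where
  le
    | zero, _ => True
    | frac _ _ _, zero => False
    | frac x y _, frac u v _ =>
      ∃ p : FinPath G, ∃ h₁ : u.d = p.r, ∃ h₂ : v.d = p.r, x = u.comp p h₁ ∧ y = v.comp p h₂

end GraphInvSemigroup

/-- Two elements `s`, `t` are orthogonal if `s⁻¹t = 0 = st⁻¹`. -/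
def Orthogonal {V : Type u} {E : Type v} {G : DirectedGraph V E} (s t : GraphInvSemigroup G) :
    Prop :=
  s⁻¹ * t = 0 ∧ s * t⁻¹ = 0

/-- `Below A a b`: the element `ab⁻¹` exists and lies below some element of `A`. -/
def Below {V : Type u} {E : Type v} {G : DirectedGraph V E} (A : Set (GraphInvSemigroup G))
    (a b : FinPath G) : Prop :=
  ∃ s ∈ A, ∃ h : a.d = b.d, GraphInvSemigroup.frac a b h ≤ s

namespace GraphInvSemigroup

theorem below_frac {V : Type u} {E : Type v} {G : DirectedGraph V E} {x y a b : FinPath G}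
    {h : x.d = y.d} : Below {frac x y h} a b ↔
      ∃ p : FinPath G, ∃ h₁ : x.d = p.r, ∃ h₂ : y.d = p.r, a = x.comp p h₁ ∧ b = y.comp p h₂ := by
  constructor
  · rintro ⟨s, rfl, h, p, h₁, h₂, ha, hb⟩
    exact ⟨p, h₁, h₂, ha, hb⟩
  · rintro ⟨p, h₁, h₂, ha, hb⟩
    refine ⟨_, rfl, ?_, p, h₁, h₂, ha, hb⟩
    rw [ha, hb, FinPath.comp_d, FinPath.comp_d]

theorem not_below_zero {V : Type u} {E : Type v} {G : DirectedGraph V E} {a b : FinPath G} :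
    ¬ Below {(0 : GraphInvSemigroup G)} a b := by
  rintro ⟨s, rfl, h, h'⟩
  exact h'

theorem eq_zero_iff {V : Type u} {E : Type v} {G : DirectedGraph V E} {s : GraphInvSemigroup G} :
    s = 0 ↔ ∀ a b, ¬ Below {s} a b := by
  constructor
  · rintro rfl a b
    exact not_below_zero
  · intro h
    cases s with
    | zero => rfl
    | frac x y hxy =>
      refine absurd (below_frac.2 ⟨⟨x.d, [], trivial⟩, rfl, hxy.symm, ?_, ?_⟩) (h x y)
      · ext1 <;> simp [FinPath.comp]
      · ext1 <;> simp [FinPath.comp]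

theorem below_inv {V : Type u} {E : Type v} {G : DirectedGraph V E} {s : GraphInvSemigroup G}
    {a b : FinPath G} : Below {s⁻¹} a b ↔ Below {s} b a := by
  cases s with
  | zero => exact ⟨fun h => absurd h not_below_zero, fun h => absurd h not_below_zero⟩
  | frac x y hxy =>
    refine below_frac.trans (Iff.trans ?_ below_frac.symm)
    constructor <;> rintro ⟨p, h₁, h₂, ha, hb⟩ <;> exact ⟨p, h₂, h₁, hb, ha⟩

theorem below_mul {V : Type u} {E : Type v} {G : DirectedGraph V E} {s t : GraphInvSemigroup G}
    {a c : FinPath G} : Below {s * t} a c ↔ ∃ b, Below {s} a b ∧ Below {t} b c := by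
  cases s with
  | zero =>
    exact ⟨fun h => absurd h not_below_zero, fun ⟨_, h, _⟩ => absurd h not_below_zero⟩
  | frac x y h =>
  cases t with
  | zero =>
    exact ⟨fun h => absurd h not_below_zero, fun ⟨_, _, h⟩ => absurd h not_below_zero⟩
  | frac u v h' =>
  by_cases H : ∃ z : FinPath G, ∃ hz : y.d = z.r, u = y.comp z hz
  · obtain ⟨z, hz, e⟩ : ∃ z : FinPath G, ∃ hz : y.d = z.r, u = y.comp z hz ∧ ∃ hd,
        frac x y h * frac u v h' = frac (x.comp z (h.trans hz)) v hd :=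
      ⟨H.choose, H.choose_spec.choose, H.choose_spec.choose_spec, _, dif_pos H⟩
    obtain ⟨rfl, hd, e⟩ := e
    rw [e, below_frac]
    simp only [below_frac]
    constructor
    · rintro ⟨p, h₁, h₂, rfl, rfl⟩
      have h3 : z.d = p.r := (FinPath.comp_d _ _ _).symm.trans h₁
      refine ⟨y.comp (z.comp p h3) hz, ⟨z.comp p h3, h.trans hz, hz, ?_, rfl⟩,
        p, h'.trans h₂, h₂, ?_, rfl⟩
      · rw [FinPath.comp_assoc]
      · rw [FinPath.comp_assoc]
    · rintro ⟨b, ⟨p, h₁, h₂, rfl, rfl⟩, q, h₃, h₄, e, rfl⟩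
      rw [FinPath.comp_assoc] at e
      obtain rfl := FinPath.comp_left_cancel e
      refine ⟨q, hd.trans h₄, h₄, ?_, rfl⟩
      rw [FinPath.comp_assoc]
  by_cases H' : ∃ z : FinPath G, ∃ hz : u.d = z.r, y = u.comp z hz
  · obtain ⟨z, hz, e⟩ : ∃ z : FinPath G, ∃ hz : u.d = z.r, y = u.comp z hz ∧ ∃ hd,
        frac x y h * frac u v h' = frac x (v.comp z (h'.symm.trans hz)) hd :=
      ⟨H'.choose, H'.choose_spec.choose, H'.choose_spec.choose_spec, _,
        (dif_neg H).trans (dif_pos H')⟩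
    obtain ⟨rfl, hd, e⟩ := e
    rw [e, below_frac]
    simp only [below_frac]
    constructor
    · rintro ⟨p, h₁, h₂, rfl, rfl⟩
      have h3 : z.d = p.r := (FinPath.comp_d _ _ _).symm.trans h₂
      refine ⟨u.comp (z.comp p h3) hz, ⟨p, h₁, h.symm.trans h₁, rfl, ?_⟩,
        z.comp p h3, hz, h'.symm.trans hz, rfl, ?_⟩
      · rw [FinPath.comp_assoc]
      · rw [FinPath.comp_assoc]
    · rintro ⟨b, ⟨p, h₁, h₂, rfl, rfl⟩, q, h₃, h₄, e, rfl⟩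
      rw [FinPath.comp_assoc] at e
      obtain rfl := FinPath.comp_left_cancel e
      refine ⟨p, h₁, hd.symm.trans h₁, rfl, ?_⟩
      rw [FinPath.comp_assoc]
  · have e : frac x y h * frac u v h' = 0 := (dif_neg H).trans (dif_neg H')
    rw [e]
    refine ⟨fun h => absurd h not_below_zero, ?_⟩
    simp only [below_frac]
    rintro ⟨b, ⟨p, h₁, h₂, rfl, rfl⟩, q, h₃, h₄, e, rfl⟩
    rcases FinPath.comparable e with ⟨z, hz, -, hz', -⟩ | ⟨z, hz, -, hz', -⟩
    · exact absurd ⟨z, hz, hz'⟩ H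
    · exact absurd ⟨z, hz, hz'⟩ H'

theorem below_right_unique {V : Type u} {E : Type v} {G : DirectedGraph V E}
    {s : GraphInvSemigroup G} {a b b' : FinPath G} (h : Below {s} a b) (h' : Below {s} a b') :
    b = b' := by
  cases s with
  | zero => exact absurd h not_below_zero
  | frac x y hxy =>
    obtain ⟨p, _, _, rfl, rfl⟩ := below_frac.1 h
    obtain ⟨q, _, _, e, rfl⟩ := below_frac.1 h'
    obtain rfl := FinPath.comp_left_cancel e
    rfl

end GraphInvSemigroup

theorem orthogonal_iff {V : Type u} {E : Type v} {G : DirectedGraph V E}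
    {s t : GraphInvSemigroup G} : Orthogonal s t ↔
      (∀ a b c, Below {s} a b → ¬ Below {t} a c) ∧ (∀ a b c, Below {s} b a → ¬ Below {t} c a) := by
  simp only [Orthogonal, GraphInvSemigroup.eq_zero_iff, GraphInvSemigroup.below_mul,
    GraphInvSemigroup.below_inv]
  constructor
  · rintro ⟨h₁, h₂⟩
    exact ⟨fun a b c hb hc => h₁ b c ⟨a, hb, hc⟩, fun a b c hb hc => h₂ b c ⟨a, hb, hc⟩⟩
  · rintro ⟨h₁, h₂⟩
    exact ⟨fun b c ⟨a, hb, hc⟩ => h₁ a b c hb hc, fun b c ⟨a, hb, hc⟩ => h₂ a b c hb hc⟩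

/-! ## The orthogonal completion and the Cuntz–Krieger semigroup -/

/-- `D(P_G)`: the finite orthogonal subsets of `P_G` that contain zero. -/
@[ext]
structure OrthCompletion {V : Type u} {E : Type v} (G : DirectedGraph V E) where
  carrier : Set (GraphInvSemigroup G)
  finite : carrier.Finite
  zero_mem : 0 ∈ carrier
  orthogonal : ∀ s ∈ carrier, ∀ t ∈ carrier, s ≠ t → Orthogonal s t

/-- Multiplication of subsets on `D(P_G)`: `AB = {ab : a ∈ A, b ∈ B}`. -/
noncomputable instance {V : Type u} {E : Type v} (G : DirectedGraph V E) :
    Mul (OrthCompletion G) where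
  mul A B :=
    { carrier := image2 (fun a b => a * b) A.carrier B.carrier
      finite := A.finite.image2 _ B.finite
      zero_mem := ⟨0, A.zero_mem, 0, B.zero_mem, rfl⟩
      orthogonal := by
        rintro _ ⟨s, hs, t, ht, rfl⟩ _ ⟨s', hs', t', ht', rfl⟩ hne
        simp only [orthogonal_iff, GraphInvSemigroup.below_mul]
        constructor
        · rintro a b c ⟨x, hx, hb⟩ ⟨y, hy, hc⟩
          by_cases hss : s = s'
          · subst hss
            obtain rfl := GraphInvSemigroup.below_right_unique hx hy
            by_cases htt : t = t'
            · exact hne (by rw [htt])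
            · exact (orthogonal_iff.1 (B.orthogonal t ht t' ht' htt)).1 _ _ _ hb hc
          · exact (orthogonal_iff.1 (A.orthogonal s hs s' hs' hss)).1 _ _ _ hx hy
        · rintro a b c ⟨x, hb, hx⟩ ⟨y, hc, hy⟩
          by_cases htt : t = t'
          · subst htt
            obtain rfl := GraphInvSemigroup.below_right_unique (GraphInvSemigroup.below_inv.2 hx)
              (GraphInvSemigroup.below_inv.2 hy)
            by_cases hss : s = s'
            · exact hne (by rw [hss])
            · exact (orthogonal_iff.1 (A.orthogonal s hs s' hs' hss)).2 _ _ _ hb hc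
          · exact (orthogonal_iff.1 (B.orthogonal t ht t' ht' htt)).2 _ _ _ hx hy }

/-- The map `ι : P_G → D(P_G)`, `s ↦ {0, s}`. -/
def iota {V : Type u} {E : Type v} {G : DirectedGraph V E} (s : GraphInvSemigroup G) :
    OrthCompletion G where
  carrier := {0, s}
  finite := Set.toFinite _
  zero_mem := Or.inl rfl
  orthogonal := by
    rintro _ (rfl | rfl) _ (rfl | rfl) hne
    · exact absurd rfl hne
    · exact orthogonal_iff.2 ⟨fun _ _ _ h => absurd h GraphInvSemigroup.not_below_zero,
        fun _ _ _ h => absurd h GraphInvSemigroup.not_below_zero⟩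
    · exact orthogonal_iff.2 ⟨fun _ _ _ _ h => GraphInvSemigroup.not_below_zero h,
        fun _ _ _ _ h => GraphInvSemigroup.not_below_zero h⟩
    · exact absurd rfl hne

/-- The Lenz arrow relation `a → B`, for an element `a` and a set `B`: for every non-zero `x ≤ a`
there is `b ∈ B` with `x ∧ b ≠ 0`, i.e. such that `x` and `b` have a non-zero common lower bound. -/
def LenzArrow {V : Type u} {E : Type v} {G : DirectedGraph V E} (a : GraphInvSemigroup G)
    (B : Set (GraphInvSemigroup G)) : Prop :=
  ∀ x, x ≠ 0 → x ≤ a → ∃ b ∈ B, ∃ z, z ≠ 0 ∧ z ≤ x ∧ z ≤ b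

/-- The relation `A ↔ B`: `a → B` for all `a ∈ A`, and `b → A` for all `b ∈ B`. -/
def LenzEquiv {V : Type u} {E : Type v} {G : DirectedGraph V E}
    (A B : Set (GraphInvSemigroup G)) : Prop :=
  (∀ a ∈ A, LenzArrow a B) ∧ ∀ b ∈ B, LenzArrow b A

theorem lenzArrow_iff {V : Type u} {E : Type v} {G : DirectedGraph V E}
    {A B : Set (GraphInvSemigroup G)} : (∀ a ∈ A, LenzArrow a B) ↔
      ∀ a b, Below A a b → ∃ p, ∃ h₁ : a.d = p.r, ∃ h₂ : b.d = p.r,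
        Below B (a.comp p h₁) (b.comp p h₂) := by
  constructor
  · rintro H a b ⟨s, hs, h, hle⟩
    obtain ⟨t, ht, z, hz, hz₁, hz₂⟩ := H s hs (.frac a b h) (by rintro ⟨⟩) hle
    cases z with
    | zero => exact absurd rfl hz
    | frac c d hcd =>
      obtain ⟨p, h₁, h₂, rfl, rfl⟩ := hz₁
      exact ⟨p, h₁, h₂, t, ht, hcd, hz₂⟩
  · intro H s hs x hx hle
    cases x with
    | zero => exact absurd rfl hx
    | frac a b h =>
      obtain ⟨p, h₁, h₂, t, ht, hd, hle'⟩ := H a b ⟨s, hs, h, hle⟩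
      exact ⟨t, ht, .frac (a.comp p h₁) (b.comp p h₂) hd, by rintro ⟨⟩, ⟨p, h₁, h₂, rfl, rfl⟩, hle'⟩

theorem below_set {V : Type u} {E : Type v} {G : DirectedGraph V E}
    {A : Set (GraphInvSemigroup G)} {a b : FinPath G} : Below A a b ↔ ∃ s ∈ A, Below {s} a b := by
  constructor
  · rintro ⟨s, hs, h⟩
    exact ⟨s, hs, s, rfl, h⟩
  · rintro ⟨s, hs, t, ht, h⟩
    rw [mem_singleton_iff.1 ht] at h
    exact ⟨s, hs, h⟩

theorem below_comp {V : Type u} {E : Type v} {G : DirectedGraph V E}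
    {A : Set (GraphInvSemigroup G)} {a b p : FinPath G} (h : Below A a b) (h₁ : a.d = p.r)
    (h₂ : b.d = p.r) : Below A (a.comp p h₁) (b.comp p h₂) := by
  obtain ⟨s, hs, h⟩ := below_set.1 h
  refine below_set.2 ⟨s, hs, ?_⟩
  cases s with
  | zero => exact absurd h GraphInvSemigroup.not_below_zero
  | frac x y hxy =>
    obtain ⟨q, h₃, h₄, rfl, rfl⟩ := GraphInvSemigroup.below_frac.1 h
    refine GraphInvSemigroup.below_frac.2 ⟨q.comp p ((FinPath.comp_d _ _ _).symm.trans h₁), h₃, h₄,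
      ?_, ?_⟩
    · rw [FinPath.comp_assoc]
    · rw [FinPath.comp_assoc]

theorem below_set_mul {V : Type u} {E : Type v} {G : DirectedGraph V E} {A B : OrthCompletion G}
    {a c : FinPath G} : Below (A * B).carrier a c ↔
      ∃ b, Below A.carrier a b ∧ Below B.carrier b c := by
  constructor
  · intro h
    obtain ⟨_, ⟨s, hs, t, ht, rfl⟩, h⟩ := below_set.1 h
    obtain ⟨b, h₁, h₂⟩ := GraphInvSemigroup.below_mul.1 h
    exact ⟨b, below_set.2 ⟨s, hs, h₁⟩, below_set.2 ⟨t, ht, h₂⟩⟩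
  · rintro ⟨b, h₁, h₂⟩
    obtain ⟨s, hs, h₁⟩ := below_set.1 h₁
    obtain ⟨t, ht, h₂⟩ := below_set.1 h₂
    exact below_set.2 ⟨s * t, ⟨s, hs, t, ht, rfl⟩, GraphInvSemigroup.below_mul.2 ⟨b, h₁, h₂⟩⟩

/-- The Lenz arrow relation is transitive. -/
theorem lenzArrow_trans {V : Type u} {E : Type v} {G : DirectedGraph V E}
    {A B C : Set (GraphInvSemigroup G)} (h : ∀ a ∈ A, LenzArrow a B)
    (h' : ∀ b ∈ B, LenzArrow b C) : ∀ a ∈ A, LenzArrow a C := by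
  rw [lenzArrow_iff] at *
  intro a b hab
  obtain ⟨p, h₁, h₂, hp⟩ := h a b hab
  obtain ⟨q, h₃, h₄, hq⟩ := h' _ _ hp
  rw [FinPath.comp_assoc, FinPath.comp_assoc] at hq
  exact ⟨_, _, _, hq⟩

/-- The Lenz arrow relation is compatible with the multiplication of `D(P_G)`. -/
theorem lenzArrow_mul {V : Type u} {E : Type v} {G : DirectedGraph V E}
    {A A' B B' : OrthCompletion G} (hA : ∀ a ∈ A.carrier, LenzArrow a A'.carrier)
    (hB : ∀ b ∈ B.carrier, LenzArrow b B'.carrier) :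
    ∀ c ∈ (A * B).carrier, LenzArrow c (A' * B').carrier := by
  rw [lenzArrow_iff] at *
  intro a c h
  obtain ⟨b, h₁, h₂⟩ := below_set_mul.1 h
  have hbc : b.d = c.d := by
    obtain ⟨_, _, h, _⟩ := h₂
    exact h
  obtain ⟨p, ha, hb, hp⟩ := hA a b h₁
  obtain ⟨q, hb', hc', hq⟩ := hB _ _ (below_comp h₂ hb (hbc.symm.trans hb))
  have ha' : (a.comp p ha).d = q.r := by rw [FinPath.comp_d, ← hb', FinPath.comp_d]
  have := below_set_mul.2 ⟨_, below_comp hp ha' hb', hq⟩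
  rw [FinPath.comp_assoc, FinPath.comp_assoc] at this
  exact ⟨_, _, _, this⟩

/-- The congruence `A ≡ B :⇔ A ↔ B` on `D(P_G)`. -/
instance lenzSetoid {V : Type u} {E : Type v} (G : DirectedGraph V E) :
    Setoid (OrthCompletion G) where
  r A B := LenzEquiv A.carrier B.carrier
  iseqv :=
    { refl := fun A => by
        have h : ∀ a ∈ A.carrier, LenzArrow a A.carrier := by
          rw [lenzArrow_iff]
          intro a b h
          have hab : a.d = b.d := by
            obtain ⟨_, _, h, _⟩ := h
            exact h
          exact ⟨⟨a.d, [], trivial⟩, rfl, hab.symm, below_comp h _ _⟩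
        exact ⟨h, h⟩
      symm := fun h => ⟨h.2, h.1⟩
      trans := fun h h' => ⟨lenzArrow_trans h.1 h'.1, lenzArrow_trans h'.2 h.2⟩ }

/-- The Cuntz–Krieger semigroup `CK_G = D(P_G)/≡`. -/
def CuntzKrieger {V : Type u} {E : Type v} (G : DirectedGraph V E) : Type (max u v) :=
  Quotient (lenzSetoid G)

noncomputable instance {V : Type u} {E : Type v} (G : DirectedGraph V E) :
    Mul (CuntzKrieger G) where
  mul := Quotient.map₂ (fun A B => A * B) fun _ _ hA _ _ hB =>
    ⟨lenzArrow_mul hA.1 hB.1, lenzArrow_mul hA.2 hB.2⟩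

/-- The map `δ : P_G → CK_G`, `δ(s) = [{0, s}]`. -/
def delta {V : Type u} {E : Type v} {G : DirectedGraph V E} (s : GraphInvSemigroup G) :
    CuntzKrieger G :=
  Quotient.mk (lenzSetoid G) (iota s)

/-- A set with a multiplication is an inverse semigroup if the multiplication is associative and
every `a` has a unique `b` with `aba = a` and `bab = b`. -/
def IsInverseSemigroup (S : Type*) [Mul S] : Prop :=
  (∀ a b c : S, a * b * c = a * (b * c)) ∧ ∀ a : S, ∃! b : S, a * b * a = a ∧ b * a * b = b

/-! ## Étale groupoids and their ample semigroups -/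

/-- The product `ab` of two arrows of a groupoid, defined when the end of `a` is the beginning of
`b`. -/
def mulArrow {C : Type u} [Groupoid.{v} C] (a b : Quiver.Total C) (h : a.right = b.left) :
    Quiver.Total C :=
  ⟨a.left, b.right, a.hom ≫ eqToHom h ≫ b.hom⟩

/-- The inverse of an arrow of a groupoid. -/
def invArrow {C : Type u} [Groupoid.{v} C] (a : Quiver.Total C) : Quiver.Total C :=
  ⟨a.right, a.left, Groupoid.inv a.hom⟩

/-- A groupoid with topologies on its sets of objects and of arrows is a topological groupoid if
both end-point maps, the identity map, the inversion and the product of composable arrows (with the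
subspace topology on the set of composable pairs) are continuous. -/
class TopologicalGroupoid (C : Type u) [Groupoid.{v} C] [TopologicalSpace C]
    [TopologicalSpace (Quiver.Total C)] : Prop where
  continuous_left : Continuous (fun a : Quiver.Total C => a.left)
  continuous_right : Continuous (fun a : Quiver.Total C => a.right)
  continuous_id : Continuous (fun x : C => (⟨x, x, 𝟙 x⟩ : Quiver.Total C))
  continuous_inv : Continuous (fun a : Quiver.Total C => invArrow a)
  continuous_mul : Continuous
    (fun p : {p : Quiver.Total C × Quiver.Total C // p.1.right = p.2.left} =>
      mulArrow p.1.1 p.1.2 p.2)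

/-- A topological groupoid is étale if its end-point maps are local homeomorphisms (it suffices to
ask this for one of them, because of the inversion). -/
class EtaleGroupoid (C : Type u) [Groupoid.{v} C] [TopologicalSpace C]
    [TopologicalSpace (Quiver.Total C)] : Prop extends TopologicalGroupoid C where
  isLocalHomeomorph_right : IsLocalHomeomorph (fun a : Quiver.Total C => a.right)

/-- A bisection: a set of arrows on which both end-point maps are injective. -/
def IsBisection {C : Type u} [Groupoid.{v} C] (A : Set (Quiver.Total C)) : Prop :=
  InjOn (fun a => a.left) A ∧ InjOn (fun a => a.right) A

/-- The product of two sets of arrows: all products `ab` of composable `a ∈ A`, `b ∈ B`. -/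
def mulSet {C : Type u} [Groupoid.{v} C] (A B : Set (Quiver.Total C)) : Set (Quiver.Total C) :=
  {c | ∃ a ∈ A, ∃ b ∈ B, ∃ h : a.right = b.left, c = mulArrow a b h}

theorem mulArrow_inv_cancel {C : Type u} [Groupoid.{v} C] (a b : Quiver.Total C)
    (h : a.right = b.left) :
    mulArrow (mulArrow a b h) (invArrow b) rfl = a := by
  obtain ⟨a₁, a₂, f⟩ := a
  obtain ⟨b₁, b₂, g⟩ := b
  dsimp at h
  subst h
  simp [mulArrow, invArrow]

theorem mulArrow_inv_cancel' {C : Type u} [Groupoid.{v} C] (c b : Quiver.Total C)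
    (h : c.right = b.right) :
    mulArrow (mulArrow c (invArrow b) h) b rfl = c := by
  obtain ⟨a₁, a₂, f⟩ := c
  obtain ⟨b₁, b₂, g⟩ := b
  dsimp at h
  subst h
  simp [mulArrow, invArrow]

theorem isBisection_mul {C : Type u} [Groupoid.{v} C] {A B : Set (Quiver.Total C)}
    (hA : IsBisection A) (hB : IsBisection B) : IsBisection (mulSet A B) := by
  constructor
  · rintro _ ⟨a, ha, b, hb, h, rfl⟩ _ ⟨a', ha', b', hb', h', rfl⟩ e
    obtain rfl := hA.1 ha ha' e
    obtain rfl := hB.1 hb hb' (h.symm.trans h')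
    rfl
  · rintro _ ⟨a, ha, b, hb, h, rfl⟩ _ ⟨a', ha', b', hb', h', rfl⟩ e
    obtain rfl := hB.2 hb hb' e
    obtain rfl := hA.2 ha ha' (h.trans h'.symm)
    rfl

theorem isCompact_mul {C : Type u} [Groupoid.{v} C] [TopologicalSpace C]
    [TopologicalSpace (Quiver.Total C)] [TopologicalGroupoid C] [T2Space (Quiver.Total C)]
    {A B : Set (Quiver.Total C)} (hA : IsCompact A) (hB : IsCompact B) :
    IsCompact (mulSet A B) := by
  have : T2Space C := T2Space.of_injective_continuous
    (f := fun x : C => (⟨x, x, 𝟙 x⟩ : Quiver.Total C)) (fun x y h => congrArg (·.left) h)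
    TopologicalGroupoid.continuous_id
  have hcl : IsClosed {p : Quiver.Total C × Quiver.Total C | p.1.right = p.2.left} :=
    isClosed_eq (TopologicalGroupoid.continuous_right.comp continuous_fst)
      (TopologicalGroupoid.continuous_left.comp continuous_snd)
  have hK := (hcl.isClosedEmbedding_subtypeVal.isCompact_preimage (hA.prod hB)).image
    TopologicalGroupoid.continuous_mul
  convert hK using 1
  ext c
  constructor
  · rintro ⟨a, ha, b, hb, h, rfl⟩
    exact ⟨⟨(a, b), h⟩, ⟨ha, hb⟩, rfl⟩
  · rintro ⟨⟨⟨a, b⟩, h⟩, ⟨ha, hb⟩, rfl⟩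
    exact ⟨a, ha, b, hb, h, rfl⟩

theorem isOpen_mul {C : Type u} [Groupoid.{v} C] [TopologicalSpace C]
    [TopologicalSpace (Quiver.Total C)] [EtaleGroupoid C]
    {A B : Set (Quiver.Total C)} (hA : IsOpen A) (hB : IsOpen B) : IsOpen (mulSet A B) := by
  rw [isOpen_iff_mem_nhds]
  rintro _ ⟨a, ha, b, hb, h, rfl⟩
  obtain ⟨e, hbe, he⟩ := EtaleGroupoid.isLocalHomeomorph_right (C := C) b
  have heq : ∀ x, e x = x.right := fun x => (congrFun he x).symm
  have hW := e.isOpen_inter_preimage_symm hB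
  set O : Set (Quiver.Total C) := {c | c.right ∈ e.target ∩ e.symm ⁻¹' B} with hO
  have hOo : IsOpen O := hW.preimage TopologicalGroupoid.continuous_right
  have hr : ∀ c : O, c.1.right = (e.symm c.1.right).right := fun c =>
    ((heq _).symm.trans (e.right_inv c.2.1)).symm
  let g : O → Quiver.Total C := fun c => mulArrow c.1 (invArrow (e.symm c.1.right)) (hr c)
  have hg : Continuous g := by
    refine TopologicalGroupoid.continuous_mul.comp
      (Continuous.subtype_mk (continuous_subtype_val.prodMk
        (TopologicalGroupoid.continuous_inv.comp ?_)) hr)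
    exact e.continuousOn_symm.comp_continuous
      (TopologicalGroupoid.continuous_right.comp continuous_subtype_val) fun c => c.2.1
  have hopen : IsOpen (Subtype.val '' (g ⁻¹' A)) :=
    hOo.isOpenMap_subtype_val _ (hA.preimage hg)
  have hb' : e.symm b.right = b := by rw [← heq, e.left_inv hbe]
  refine Filter.mem_of_superset (hopen.mem_nhds ?_) ?_
  · have hmem : mulArrow a b h ∈ O := by
      refine ⟨?_, ?_⟩
      · change b.right ∈ e.target
        rw [← heq]
        exact e.map_source hbe
      · change e.symm b.right ∈ B
        rwa [hb']
    refine ⟨⟨_, hmem⟩, ?_, rfl⟩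
    have key : ∀ b' (hb' : b' = b) (h' : b.right = b'.right),
        mulArrow (mulArrow a b h) (invArrow b') h' = a := by
      rintro _ rfl _
      exact mulArrow_inv_cancel a _ h
    change g _ ∈ A
    have : g ⟨_, hmem⟩ = a := key _ hb' _
    rwa [this]
  · rintro _ ⟨c, hc, rfl⟩
    exact ⟨g c, hc, e.symm c.1.right, c.2.2, rfl, (mulArrow_inv_cancel' _ _ (hr c)).symm⟩

/-- The ample semigroup of a groupoid: the set of its compact-open bisections. -/
def AmpleSemigroup (C : Type u) [Groupoid.{v} C] [TopologicalSpace (Quiver.Total C)] :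
    Type (max u v) :=
  {A : Set (Quiver.Total C) // IsCompact A ∧ IsOpen A ∧ IsBisection A}

/-- In a Hausdorff étale groupoid the compact-open bisections are multiplied as sets of arrows. -/
instance {C : Type u} [Groupoid.{v} C] [TopologicalSpace C] [TopologicalSpace (Quiver.Total C)]
    [EtaleGroupoid C] [T2Space (Quiver.Total C)] : Mul (AmpleSemigroup C) where
  mul A B := ⟨mulSet A.1 B.1, isCompact_mul A.2.1 B.2.1, isOpen_mul A.2.2.1 B.2.2.1,
    isBisection_mul A.2.2.2 B.2.2.2⟩

/-! ## The groupoid of triples -/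

/-- `(w, k, w')` is an element of the groupoid `𝒢` of the graph: there are finite paths `u`, `v`
with `u⁻¹w = v⁻¹w'` and `|v| - |u| = k`. -/
def IsTriple {V : Type u} {E : Type v} {G : DirectedGraph V E} (w : InfPath G) (k : ℤ)
    (w' : InfPath G) : Prop :=
  ∃ u v : FinPath G, ∃ w₀ : InfPath G, ∃ hu : u.d = w₀.r, ∃ hv : v.d = w₀.r,
    w = u.prepend w₀ hu ∧ w' = v.prepend w₀ hv ∧ (v.length : ℤ) - u.length = k

theorem isTriple_id {V : Type u} {E : Type v} {G : DirectedGraph V E} (w : InfPath G) :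
    IsTriple w 0 w :=
  ⟨⟨w.r, [], trivial⟩, ⟨w.r, [], trivial⟩, w, rfl, rfl, rfl, rfl, sub_self _⟩

theorem isTriple_inv {V : Type u} {E : Type v} {G : DirectedGraph V E} {w w' : InfPath G} {k : ℤ}
    (h : IsTriple w k w') : IsTriple w' (-k) w := by
  obtain ⟨u, v, w₀, hu, hv, e, e', hk⟩ := h
  exact ⟨v, u, w₀, hv, hu, e', e, by rw [← hk, neg_sub]⟩

theorem isTriple_mul {V : Type u} {E : Type v} {G : DirectedGraph V E} {w w' w'' : InfPath G}
    {k l : ℤ} (h : IsTriple w k w') (h' : IsTriple w' l w'') : IsTriple w (k + l) w'' := by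
  obtain ⟨u, v, w₀, hu, hv, rfl, rfl, rfl⟩ := h
  obtain ⟨x, y, w₁, hx, hy, e, rfl, rfl⟩ := h'
  rcases FinPath.prepend_comparable e with ⟨z, hz, hz', rfl, rfl⟩ | ⟨z, hz, hz', rfl, rfl⟩
  · have huz : u.d = z.r := hu.trans (z.prepend_r _ _)
    refine ⟨u.comp z huz, y, w₁, (FinPath.comp_d _ _ _).trans hz', hy, ?_, rfl, ?_⟩
    · rw [FinPath.comp_prepend]
    · simp only [FinPath.length, FinPath.comp, List.length_append]
      push_cast
      ring
  · have hyz : y.d = z.r := hy.trans (z.prepend_r _ _)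
    refine ⟨u, y.comp z hyz, w₀, hu, (FinPath.comp_d _ _ _).trans hz', rfl, ?_, ?_⟩
    · rw [FinPath.comp_prepend]
    · simp only [FinPath.length, FinPath.comp, List.length_append]
      push_cast
      ring

/-- The groupoid `𝒢` of the graph `G`. Its objects are the infinite paths and its arrows are the
triples `(w, k, w')`, with `(w, k, w')(w', l, w'') = (w, k + l, w'')`, `(w, k, w')⁻¹ = (w', -k, w)`
and identities `(w, 0, w)`. -/
instance InfPath.instGroupoid {V : Type u} {E : Type v} (G : DirectedGraph V E) :
    Groupoid (InfPath G) where
  Hom w w' := {k : ℤ // IsTriple w k w'}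
  id w := ⟨0, isTriple_id w⟩
  comp f g := ⟨f.1 + g.1, isTriple_mul f.2 g.2⟩
  inv f := ⟨-f.1, isTriple_inv f.2⟩
  id_comp _ := Subtype.ext (zero_add _)
  comp_id _ := Subtype.ext (add_zero _)
  assoc _ _ _ := Subtype.ext (add_assoc _ _ _)
  inv_comp _ := Subtype.ext (neg_add_cancel _)
  comp_inv _ := Subtype.ext (add_neg_cancel _)

/-- The set `Z(x, y)` of all triples `(w, k, w')` with `x⁻¹w = y⁻¹w'` and `k = |y| - |x|`. -/
def basicBisection {V : Type u} {E : Type v} {G : DirectedGraph V E} (x y : FinPath G) :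
    Set (Quiver.Total (InfPath G)) :=
  {a | (∃ w₀ : InfPath G, ∃ hx : x.d = w₀.r, ∃ hy : y.d = w₀.r,
      a.left = x.prepend w₀ hx ∧ a.right = y.prepend w₀ hy) ∧
    a.hom.1 = (y.length : ℤ) - x.length}

/-- The topology on the set of arrows of `𝒢`, generated by the sets `Z(x, y)`. -/
instance InfPath.instTopologicalSpaceTotal {V : Type u} {E : Type v} (G : DirectedGraph V E) :
    TopologicalSpace (Quiver.Total (InfPath G)) :=
  TopologicalSpace.generateFrom {A | ∃ x y : FinPath G, A = basicBisection x y}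

end GraphCK

/-! A finite orthogonal set `A` is sent to its `realization`, the union of the sets `Z(x, y)` over
the fractions `xy⁻¹` in `A`; this induces the isomorphism.

Everything rests on one combinatorial fact (`exists_comp_of_mem`): two sets `Z(x, y)` and `Z(s, t)`
with a common arrow are nested, and if `|x| ≤ |s|` then `s = xz` and `t = yz` for one path `z`. So
these sets form a basis, and the natural order on fractions mirrors their inclusion. On `Z(x, y)`
the right end is injective, continuous and open with image `cylinder y`, which gives étaleness.
Cylinders are compact because only finitely many edges enter each vertex, so every realization is
compact; the groupoid is Hausdorff, so it is also closed.

`A → B` says that every basic open piece below `A` can be shrunk to one below `B`, that is, the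
realization of `B` is dense in that of `A`. Closedness turns this into inclusion, and non-emptiness
of all `Z(x, y)` with `d x = d y` gives the converse (`lenzArrow_iff_realization_subset`). Hence `≡`
is equality of realizations, which makes the induced map well defined and injective.

It is multiplicative since a fraction below `st` factors as `ab⁻¹ · bc⁻¹` with factors below `s` and
`t` (`realization_mul`). It is onto since a compact open set is a finite disjoint union of sets
`Z(x, y)`, and inside a bisection disjointness forces orthogonality (`exists_realization_eq`).
Compact-open bisections form an inverse semigroup with `A⁻¹` the set of inverse arrows, and this
property is transported to `CK_G`. -/

namespace GraphCK

universe u v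

variable {V : Type u} {E : Type v} {G : DirectedGraph V E}

/-! ### Prefixes of infinite paths -/

/-- The empty path at a vertex. -/
def FinPath.one (G : DirectedGraph V E) (a : V) : FinPath G := ⟨a, [], trivial⟩

theorem FinPath.length_comp (x z : FinPath G) (h : x.d = z.r) :
    (x.comp z h).length = x.length + z.length := by
  simp [FinPath.length, FinPath.comp]

theorem FinPath.comp_one (x : FinPath G) {a : V} (h : x.d = (FinPath.one G a).r) :
    x.comp (FinPath.one G a) h = x := by
  ext1 <;> simp [FinPath.comp, FinPath.one]

theorem FinPath.comp_eq_of_length_eq_zero (x z : FinPath G) (h : x.d = z.r)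
    (hz : z.length = 0) : x.comp z h = x := by
  ext1
  · rfl
  · simp [FinPath.comp, List.length_eq_zero_iff.1 hz]

theorem FinPath.prepend_one (w : InfPath G) {a : V} (h : (FinPath.one G a).d = w.r) :
    (FinPath.one G a).prepend w h = w := rfl

theorem FinPath.prepend_left_cancel {x : FinPath G} {w w' : InfPath G} {h : x.d = w.r}
    {h' : x.d = w'.r} (e : x.prepend w h = x.prepend w' h') : w = w' := by
  ext1
  have he : x.edges ++ₛ w.edges = x.edges ++ₛ w'.edges := congrArg InfPath.edges e
  rw [← Stream'.drop_append_stream x.edges w.edges, he, Stream'.drop_append_stream]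

/-- In the second alternative of `prepend_comparable` the length bound forces `z` to be empty, so `x
= y` and the empty path is the witness. -/
theorem FinPath.exists_comp_of_prepend_eq {x y : FinPath G} {w w' : InfPath G} {h : x.d = w.r}
    {h' : y.d = w'.r} (e : x.prepend w h = y.prepend w' h') (hl : x.length ≤ y.length) :
    ∃ z, ∃ hz : x.d = z.r, ∃ hz' : z.d = w'.r, y = x.comp z hz ∧ w = z.prepend w' hz' := by
  rcases FinPath.prepend_comparable e with H | ⟨z, hz, hz', rfl, rfl⟩
  · exact H
  · have hz0 : z.length = 0 := by rw [FinPath.length_comp] at hl; omega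
    have hxy : y.comp z hz = y := FinPath.comp_eq_of_length_eq_zero _ _ _ hz0
    have hw : z.prepend w hz' = w := by
      ext1
      simp [FinPath.prepend, List.length_eq_zero_iff.1 hz0]
    have hd : y.d = w.r := by rw [← hxy]; exact h
    refine ⟨FinPath.one G y.d, congrArg FinPath.d hxy, ?_, ?_, ?_⟩
    · rw [hw]; exact hd
    · exact hxy.symm.trans (FinPath.comp_one _ (a := y.d) (congrArg FinPath.d hxy)).symm
    · rw [FinPath.prepend_one, hw]

/-- The first edge of an infinite path can be split off. -/
theorem InfPath.exists_eq_prepend_one (w : InfPath G) :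
    ∃ p : FinPath G, ∃ w' : InfPath G, ∃ h : p.d = w'.r, w = p.prepend w' h ∧ p.length = 1 := by
  refine ⟨⟨w.r, [w.edges.get 0], rfl, trivial⟩, ⟨w.edges.tail, fun n => w.isPath (n + 1)⟩,
    w.isPath 0, ?_, rfl⟩
  ext1
  exact (Stream'.eta w.edges).symm

theorem InfPath.exists_eq_prepend (w : InfPath G) (n : ℕ) :
    ∃ p : FinPath G, ∃ w' : InfPath G, ∃ h : p.d = w'.r, w = p.prepend w' h ∧ p.length = n := by
  induction n with
  | zero => exact ⟨FinPath.one G w.r, w, rfl, rfl, rfl⟩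
  | succ n ih =>
    obtain ⟨p, w, h, rfl, hp⟩ := ih
    obtain ⟨q, w, h', rfl, hq⟩ := w.exists_eq_prepend_one
    have hpq : p.d = q.r := h.trans (q.prepend_r w h')
    exact ⟨p.comp q hpq, w, (p.comp_d q hpq).trans h', (p.comp_prepend q w hpq h').symm,
      by rw [FinPath.length_comp, hp, hq]⟩

/-- Choose an edge into every vertex; each next edge is the chosen one into the source of the
present edge. This is what makes `Z(x, y)` non-empty whenever `d x = d y`. -/
theorem exists_infPath_r_eq (hne : ∀ a : V, ∃ e : E, G.r e = a) (a : V) :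
    ∃ w : InfPath G, w.r = a := by
  choose f hf using hne
  exact ⟨⟨Stream'.iterate (fun e => f (G.d e)) (f a), fun n => (hf _).symm⟩, hf a⟩

/-! ### The arrows of the groupoid and the sets `Z(x, y)` -/

/-- The arrow `(xw, |y| - |x|, yw)`. -/
def arrow (x y : FinPath G) (w : InfPath G) (hx : x.d = w.r) (hy : y.d = w.r) :
    Quiver.Total (InfPath G) :=
  ⟨x.prepend w hx, y.prepend w hy, ⟨(y.length : ℤ) - x.length, x, y, w, hx, hy, rfl, rfl, rfl⟩⟩

theorem total_ext {a b : Quiver.Total (InfPath G)} (hl : a.left = b.left)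
    (hr : a.right = b.right) (hk : a.hom.1 = b.hom.1) : a = b := by
  obtain ⟨a₁, a₂, f⟩ := a
  obtain ⟨b₁, b₂, g⟩ := b
  dsimp at hl hr
  subst hl hr
  obtain rfl : f = g := Subtype.ext hk
  rfl

theorem mem_basicBisection {x y : FinPath G} {a : Quiver.Total (InfPath G)} :
    a ∈ basicBisection x y ↔
      ∃ w : InfPath G, ∃ hx : x.d = w.r, ∃ hy : y.d = w.r, a = arrow x y w hx hy := by
  constructor
  · rintro ⟨⟨w, hx, hy, hl, hr⟩, hk⟩
    exact ⟨w, hx, hy, total_ext hl hr hk⟩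
  · rintro ⟨w, hx, hy, rfl⟩
    exact ⟨⟨w, hx, hy, rfl, rfl⟩, rfl⟩

theorem arrow_mem (x y : FinPath G) (w : InfPath G) (hx : x.d = w.r) (hy : y.d = w.r) :
    arrow x y w hx hy ∈ basicBisection x y :=
  mem_basicBisection.2 ⟨w, hx, hy, rfl⟩

theorem basicBisection_d_eq {x y : FinPath G} {a : Quiver.Total (InfPath G)}
    (h : a ∈ basicBisection x y) : x.d = y.d := by
  obtain ⟨w, hx, hy, -⟩ := mem_basicBisection.1 h
  exact hx.trans hy.symm

/-- A common suffix `z` may be moved into the infinite tail: its length cancels in the degree. -/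
theorem arrow_comp (x y z : FinPath G) (w : InfPath G) (hx : x.d = z.r) (hy : y.d = z.r)
    (hz : z.d = w.r) :
    arrow (x.comp z hx) (y.comp z hy) w ((x.comp_d z hx).trans hz) ((y.comp_d z hy).trans hz) =
      arrow x y (z.prepend w hz) (hx.trans (z.prepend_r w hz).symm)
        (hy.trans (z.prepend_r w hz).symm) := by
  refine total_ext (x.comp_prepend z w hx hz) (y.comp_prepend z w hy hz) ?_
  simp [arrow, FinPath.length_comp]

theorem basicBisection_comp_subset (x y z : FinPath G) (hx : x.d = z.r) (hy : y.d = z.r) :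
    basicBisection (x.comp z hx) (y.comp z hy) ⊆ basicBisection x y := by
  intro a ha
  obtain ⟨w, h, -, rfl⟩ := mem_basicBisection.1 ha
  rw [arrow_comp x y z w hx hy ((x.comp_d z hx).symm.trans h)]
  exact arrow_mem _ _ _ _ _

/-- Both `x` and `s` are prefixes of the left end, both `y` and `t` of the right end. The common
degree makes `s` exceed `x` by as much as `t` exceeds `y`, and the two surplus pieces start the same
tail, so they coincide. -/
theorem exists_comp_of_mem {x y s t : FinPath G} {a : Quiver.Total (InfPath G)}
    (h : a ∈ basicBisection x y) (h' : a ∈ basicBisection s t) (hl : x.length ≤ s.length) :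
    ∃ z : FinPath G, ∃ hx : x.d = z.r, ∃ hy : y.d = z.r, s = x.comp z hx ∧ t = y.comp z hy := by
  obtain ⟨w, hx, hy, rfl⟩ := mem_basicBisection.1 h
  obtain ⟨⟨w', hs, ht, el, er⟩, hk⟩ := h'
  obtain ⟨z, hz, hz', rfl, rfl⟩ := FinPath.exists_comp_of_prepend_eq (h := hx) el hl
  have hk : (y.length : ℤ) - x.length = t.length - (x.comp z hz).length := hk
  rw [FinPath.length_comp] at hk
  push_cast at hk
  obtain ⟨z', h₁, h₂, rfl, e⟩ := FinPath.exists_comp_of_prepend_eq (h := hy) er (by omega)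
  have hyz : y.d = z.r := hy.trans (z.prepend_r _ _)
  have hlen : z.length = z'.length := by rw [FinPath.length_comp] at hk; push_cast at hk; omega
  -- `z` and `z'` are prefixes of equal length of one infinite path, so the surplus `p` is empty.
  obtain ⟨p, hp, -, rfl, -⟩ := FinPath.exists_comp_of_prepend_eq e hlen.le
  have hp0 : p.length = 0 := by rw [FinPath.length_comp] at hlen; omega
  exact ⟨z, hz, hyz, rfl, by simp only [FinPath.comp_eq_of_length_eq_zero z p hp hp0]⟩

/-- Of two sets `Z(x, y)` with a common element, the one with the longer paths is contained in the
other. -/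
theorem basicBisection_subset_of_mem {x y s t : FinPath G} {a : Quiver.Total (InfPath G)}
    (h : a ∈ basicBisection x y) (h' : a ∈ basicBisection s t) (hl : x.length ≤ s.length) :
    basicBisection s t ⊆ basicBisection x y := by
  obtain ⟨z, hx, hy, rfl, rfl⟩ := exists_comp_of_mem h h' hl
  exact basicBisection_comp_subset x y z hx hy

theorem eq_of_mem_basicBisection {x y s t : FinPath G} {a : Quiver.Total (InfPath G)}
    (h : a ∈ basicBisection x y) (h' : a ∈ basicBisection s t) (hl : x.length = s.length) :
    s = x ∧ t = y := by
  obtain ⟨z, hx, hy, rfl, rfl⟩ := exists_comp_of_mem h h' hl.le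
  have hz : z.length = 0 := by rw [FinPath.length_comp] at hl; omega
  exact ⟨FinPath.comp_eq_of_length_eq_zero _ _ _ hz, FinPath.comp_eq_of_length_eq_zero _ _ _ hz⟩

/-- Moves `n` edges from the tail to both paths. Long paths are how a basic neighbourhood is pushed
inside a given one. -/
theorem exists_arrow_comp (x y : FinPath G) (w : InfPath G) (hx : x.d = w.r) (hy : y.d = w.r)
    (n : ℕ) : ∃ z : FinPath G, ∃ hxz : x.d = z.r, ∃ hyz : y.d = z.r,
      arrow x y w hx hy ∈ basicBisection (x.comp z hxz) (y.comp z hyz) ∧ z.length = n := by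
  obtain ⟨z, w, hz, rfl, hn⟩ := w.exists_eq_prepend n
  have hxz := hx.trans (z.prepend_r _ _)
  have hyz := hy.trans (z.prepend_r _ _)
  refine ⟨z, hxz, hyz, ?_, hn⟩
  rw [← arrow_comp x y z w hxz hyz hz]
  exact arrow_mem _ _ _ _ _

theorem exists_eq_arrow (a : Quiver.Total (InfPath G)) :
    ∃ (x y : FinPath G) (w : InfPath G) (hx : x.d = w.r) (hy : y.d = w.r),
      a = arrow x y w hx hy := by
  obtain ⟨x, y, w, hx, hy, hl, hr, hk⟩ := a.hom.2
  exact ⟨x, y, w, hx, hy, total_ext hl hr hk.symm⟩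

theorem exists_mem_basicBisection (a : Quiver.Total (InfPath G)) (n : ℕ) :
    ∃ x y : FinPath G, a ∈ basicBisection x y ∧ n ≤ x.length ∧ n ≤ y.length := by
  obtain ⟨x, y, w, hx, hy, rfl⟩ := exists_eq_arrow a
  obtain ⟨z, hxz, hyz, h, hn⟩ := exists_arrow_comp x y w hx hy n
  refine ⟨_, _, h, ?_, ?_⟩ <;> rw [FinPath.length_comp] <;> omega

theorem isTopologicalBasis_basicBisection (G : DirectedGraph V E) :
    TopologicalSpace.IsTopologicalBasis {A | ∃ x y : FinPath G, A = basicBisection x y} where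
  exists_subset_inter := by
    rintro _ ⟨x, y, rfl⟩ _ ⟨s, t, rfl⟩ a ⟨h, h'⟩
    rcases le_total x.length s.length with hl | hl
    · exact ⟨_, ⟨s, t, rfl⟩, h',
        subset_inter (basicBisection_subset_of_mem h h' hl) subset_rfl⟩
    · exact ⟨_, ⟨x, y, rfl⟩, h,
        subset_inter subset_rfl (basicBisection_subset_of_mem h' h hl)⟩
  sUnion_eq := by
    refine eq_univ_of_forall fun a => ?_
    obtain ⟨x, y, h, -⟩ := exists_mem_basicBisection a 0
    exact ⟨_, ⟨x, y, rfl⟩, h⟩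
  eq_generateFrom := rfl

theorem isOpen_basicBisection (x y : FinPath G) : IsOpen (basicBisection x y) :=
  (isTopologicalBasis_basicBisection G).isOpen ⟨x, y, rfl⟩

theorem isOpen_cylinder (x : FinPath G) : IsOpen (cylinder x) :=
  TopologicalSpace.isOpen_generateFrom_of_mem ⟨x, rfl⟩

theorem prepend_mem_cylinder (x : FinPath G) (w : InfPath G) (h : x.d = w.r) :
    x.prepend w h ∈ cylinder x := ⟨w, h, rfl⟩

theorem cylinder_comp_subset (x z : FinPath G) (h : x.d = z.r) :
    cylinder (x.comp z h) ⊆ cylinder x := by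
  rintro _ ⟨w, h', rfl⟩
  rw [x.comp_prepend z w h ((x.comp_d z h).symm.trans h')]
  exact prepend_mem_cylinder _ _ _

theorem cylinder_subset_of_mem {x y : FinPath G} {w : InfPath G} (h : w ∈ cylinder x)
    (h' : w ∈ cylinder y) (hl : x.length ≤ y.length) : cylinder y ⊆ cylinder x := by
  obtain ⟨w₁, h₁, rfl⟩ := h
  obtain ⟨w₂, h₂, e⟩ := h'
  obtain ⟨z, hz, -, rfl, -⟩ := FinPath.exists_comp_of_prepend_eq e hl
  exact cylinder_comp_subset x z hz

/-! ### The groupoid is étale -/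

theorem mulArrow_arrow (x y z : FinPath G) (w : InfPath G) (hx : x.d = w.r) (hy : y.d = w.r)
    (hz : z.d = w.r) (h : (arrow x y w hx hy).right = (arrow y z w hy hz).left) :
    mulArrow (arrow x y w hx hy) (arrow y z w hy hz) h = arrow x z w hx hz := by
  refine total_ext rfl rfl ?_
  change ((y.length : ℤ) - x.length) + (0 + ((z.length : ℤ) - y.length)) = z.length - x.length
  ring

theorem invArrow_arrow (x y : FinPath G) (w : InfPath G) (hx : x.d = w.r) (hy : y.d = w.r) :
    invArrow (arrow x y w hx hy) = arrow y x w hy hx := by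
  refine total_ext rfl rfl ?_
  change -((y.length : ℤ) - x.length) = x.length - y.length
  ring

theorem invArrow_mem_basicBisection {x y : FinPath G} {a : Quiver.Total (InfPath G)}
    (h : a ∈ basicBisection x y) : invArrow a ∈ basicBisection y x := by
  obtain ⟨w, hx, hy, rfl⟩ := mem_basicBisection.1 h
  rw [invArrow_arrow]
  exact arrow_mem _ _ _ _ _

theorem mulArrow_mem_basicBisection {x y z : FinPath G} {a b : Quiver.Total (InfPath G)}
    (ha : a ∈ basicBisection x y) (hb : b ∈ basicBisection y z) (h : a.right = b.left) :
    mulArrow a b h ∈ basicBisection x z := by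
  obtain ⟨w, hx, hy, rfl⟩ := mem_basicBisection.1 ha
  obtain ⟨w', hy', hz, rfl⟩ := mem_basicBisection.1 hb
  obtain rfl : w = w' := FinPath.prepend_left_cancel (x := y) (h := hy) (h' := hy') h
  rw [mulArrow_arrow]
  exact arrow_mem _ _ _ _ _

/-- Composable arrows lie in sets `Z(x, y)` and `Z(y, z)` with arbitrarily long paths. -/
theorem exists_mem_basicBisection_of_composable {a b : Quiver.Total (InfPath G)}
    (h : a.right = b.left) (n : ℕ) : ∃ x y z : FinPath G,
      a ∈ basicBisection x y ∧ b ∈ basicBisection y z ∧ n ≤ x.length := by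
  obtain ⟨x, y, w, hx, hy, rfl⟩ := exists_eq_arrow a
  obtain ⟨s, t, w', hs, ht, rfl⟩ := exists_eq_arrow b
  -- The summand `s.length` makes `s` a prefix of the extended `y`; the summand `n` gives the
  -- required length.
  obtain ⟨p, hxp, hyp, hp, hn⟩ := exists_arrow_comp x y w hx hy (n + s.length)
  obtain ⟨w₁, h₁, h₂, e⟩ := mem_basicBisection.1 hp
  have hr : (y.comp p hyp).prepend w₁ h₂ = s.prepend w' hs :=
    (congrArg (fun c => c.right) e).symm.trans h
  obtain ⟨q, hq, hq', e', rfl⟩ := FinPath.exists_comp_of_prepend_eq hr.symm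
    (by rw [FinPath.length_comp]; omega)
  have htq : t.d = q.r := ht.trans (q.prepend_r _ _)
  refine ⟨_, _, t.comp q htq, hp, ?_, by rw [FinPath.length_comp]; omega⟩
  rw [e', ← arrow_comp s t q w₁ hq htq hq']
  exact arrow_mem _ _ _ _ _

theorem continuous_right : Continuous (fun a : Quiver.Total (InfPath G) => a.right) := by
  refine continuous_generateFrom_iff.2 ?_
  rintro _ ⟨u, rfl⟩
  rw [(isTopologicalBasis_basicBisection G).isOpen_iff]
  intro a ha
  obtain ⟨x, y, h, -, hl⟩ := exists_mem_basicBisection a u.length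
  refine ⟨_, ⟨x, y, rfl⟩, h, fun b hb => ?_⟩
  obtain ⟨w, hx, hy, rfl⟩ := mem_basicBisection.1 h
  obtain ⟨w', hx', hy', rfl⟩ := mem_basicBisection.1 hb
  exact cylinder_subset_of_mem ha (prepend_mem_cylinder y w hy) hl (prepend_mem_cylinder y w' hy')

theorem continuous_invArrow :
    Continuous (fun a : Quiver.Total (InfPath G) => invArrow a) := by
  refine continuous_generateFrom_iff.2 ?_
  rintro _ ⟨x, y, rfl⟩
  convert isOpen_basicBisection y x using 1
  ext a
  refine ⟨fun h => ?_, invArrow_mem_basicBisection⟩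
  have := invArrow_mem_basicBisection h
  have e : invArrow (invArrow a) = a := total_ext rfl rfl (neg_neg _)
  rwa [e] at this

theorem continuous_left : Continuous (fun a : Quiver.Total (InfPath G) => a.left) :=
  continuous_right.comp continuous_invArrow

theorem continuous_idArrow :
    Continuous (fun w : InfPath G => (⟨w, w, 𝟙 w⟩ : Quiver.Total (InfPath G))) := by
  refine continuous_generateFrom_iff.2 ?_
  rintro _ ⟨x, y, rfl⟩
  rw [isOpen_iff_mem_nhds]
  intro w hw
  obtain ⟨w₀, hx, hy, e⟩ := mem_basicBisection.1 hw
  have hl : w = x.prepend w₀ hx := congrArg (fun c => c.left) e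
  have hr : w = y.prepend w₀ hy := congrArg (fun c => c.right) e
  have hk : (0 : ℤ) = y.length - x.length :=
    congrArg (fun c : Quiver.Total (InfPath G) => c.hom.1) e
  -- An identity has degree zero, so `x` and `y` are prefixes of `w` of equal length and agree; then
  -- all of `cylinder x` maps into `Z(x, y)`.
  obtain ⟨z, hz, -, rfl, -⟩ := FinPath.exists_comp_of_prepend_eq (hl.symm.trans hr) (by omega)
  rw [FinPath.length_comp] at hk
  push_cast at hk
  have hxz := FinPath.comp_eq_of_length_eq_zero x z hz (by omega)
  refine Filter.mem_of_superset ((isOpen_cylinder x).mem_nhds (hl ▸ prepend_mem_cylinder _ _ _)) ?_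
  rintro _ ⟨w', h, rfl⟩
  rw [hxz]
  refine mem_basicBisection.2 ⟨w', h, h, total_ext rfl rfl ?_⟩
  exact (sub_self _).symm

/-- Products from `Z(x, y)` and `Z(y, z)` lie in `Z(x, z)`, which sits inside the prescribed `Z(s,
t)` once `x` is at least as long as `s`. -/
theorem continuous_mulArrow : Continuous
    (fun p : {p : Quiver.Total (InfPath G) × Quiver.Total (InfPath G) // p.1.right = p.2.left} =>
      mulArrow p.1.1 p.1.2 p.2) := by
  refine continuous_generateFrom_iff.2 ?_
  rintro _ ⟨s, t, rfl⟩
  rw [isOpen_iff_mem_nhds]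
  rintro ⟨⟨a, b⟩, h⟩ hab
  obtain ⟨x, y, z, ha, hb, hl⟩ := exists_mem_basicBisection_of_composable h s.length
  have hU : IsOpen (basicBisection x y ×ˢ basicBisection y z) :=
    (isOpen_basicBisection x y).prod (isOpen_basicBisection y z)
  refine Filter.mem_of_superset ((hU.preimage continuous_subtype_val).mem_nhds ⟨ha, hb⟩) ?_
  rintro ⟨⟨a', b'⟩, h'⟩ ⟨ha', hb'⟩
  exact basicBisection_subset_of_mem hab (mulArrow_mem_basicBisection ha hb h) hl
    (mulArrow_mem_basicBisection ha' hb' h')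

theorem right_image_basicBisection {x y : FinPath G} (h : x.d = y.d) :
    (fun a : Quiver.Total (InfPath G) => a.right) '' basicBisection x y = cylinder y := by
  ext w
  constructor
  · rintro ⟨a, ha, rfl⟩
    obtain ⟨w, hx, hy, rfl⟩ := mem_basicBisection.1 ha
    exact prepend_mem_cylinder _ _ hy
  · rintro ⟨w, hy, rfl⟩
    exact ⟨_, arrow_mem x y w (h.trans hy) hy, rfl⟩

theorem right_injOn_basicBisection (x y : FinPath G) :
    InjOn (fun a : Quiver.Total (InfPath G) => a.right) (basicBisection x y) := by
  intro a ha b hb e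
  obtain ⟨w, hx, hy, rfl⟩ := mem_basicBisection.1 ha
  obtain ⟨w', hx', hy', rfl⟩ := mem_basicBisection.1 hb
  obtain rfl := FinPath.prepend_left_cancel (x := y) (h := hy) (h' := hy') e
  rfl

theorem isOpenMap_right : IsOpenMap (fun a : Quiver.Total (InfPath G) => a.right) := by
  rw [(isTopologicalBasis_basicBisection G).isOpenMap_iff]
  rintro _ ⟨x, y, rfl⟩
  by_cases h : x.d = y.d
  · rw [right_image_basicBisection h]
    exact isOpen_cylinder y
  · rw [eq_empty_of_forall_notMem fun a (ha : a ∈ basicBisection x y) => h (basicBisection_d_eq ha),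
      image_empty]
    exact isOpen_empty

theorem isOpenEmbedding_right_restrict (x y : FinPath G) : IsOpenEmbedding
    ((basicBisection x y).domRestrict (fun a : Quiver.Total (InfPath G) => a.right)) :=
  .of_continuous_injective_isOpenMap (continuous_right.comp continuous_subtype_val)
    (injOn_iff_injective.1 (right_injOn_basicBisection x y))
    (isOpenMap_right.domRestrict (isOpen_basicBisection x y))

instance etaleGroupoid (G : DirectedGraph V E) : EtaleGroupoid (InfPath G) where
  continuous_left := continuous_left
  continuous_right := continuous_right
  continuous_id := continuous_idArrow
  continuous_inv := continuous_invArrow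
  continuous_mul := continuous_mulArrow
  isLocalHomeomorph_right := by
    rw [isLocalHomeomorph_iff_isOpenEmbedding_restrict]
    intro a
    obtain ⟨x, y, h, -⟩ := exists_mem_basicBisection a 0
    exact ⟨_, (isOpen_basicBisection x y).mem_nhds h, isOpenEmbedding_right_restrict x y⟩

/-! ### Compact sets of infinite paths and separation -/

/-- Coordinates allow comparison with the product topology. The condition on `w.r` matters only when
`x` is empty. -/
theorem cylinder_eq (x : FinPath G) : cylinder x =
    {w | w.r = x.r ∧ ∀ i (h : i < x.edges.length), w.edges.get i = x.edges[i]} := by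
  ext w
  constructor
  · rintro ⟨w, h, rfl⟩
    exact ⟨x.prepend_r w h, fun i hi => Stream'.get_append_left i _ _ hi⟩
  · rintro ⟨hr, hw⟩
    obtain ⟨p, w, hp, rfl, hl⟩ := w.exists_eq_prepend x.length
    obtain rfl : p = x := by
      ext1
      · exact (p.prepend_r w hp).symm.trans hr
      · refine List.ext_getElem hl fun i h₁ h₂ => ?_
        rw [← hw i h₂]
        exact (Stream'.get_append_left i _ _ h₁).symm
    exact prepend_mem_cylinder _ _ _

theorem isOpen_setOf_get_eq (n : ℕ) (e : E) : IsOpen {w : InfPath G | w.edges.get n = e} := by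
  rw [isOpen_iff_mem_nhds]
  intro w hw
  obtain ⟨p, w, hp, rfl, hl⟩ := w.exists_eq_prepend (n + 1)
  refine Filter.mem_of_superset ((isOpen_cylinder p).mem_nhds (prepend_mem_cylinder _ _ _)) ?_
  rintro _ ⟨w', h', rfl⟩
  have hn : n < p.edges.length := by
    have : p.edges.length = n + 1 := hl
    omega
  have h₁ := Stream'.get_append_left n p.edges w.edges hn
  have h₂ := Stream'.get_append_left n p.edges w'.edges hn
  exact h₂.trans (h₁.symm.trans hw)

/-- The topology of `G^ω` is that of a subspace of the product of copies of the discrete space of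
edges. -/
theorem isEmbedding_edges [TopologicalSpace E] [DiscreteTopology E] :
    IsEmbedding (fun (w : InfPath G) (n : ℕ) => w.edges.get n) := by
  have hc : Continuous (fun (w : InfPath G) (n : ℕ) => w.edges.get n) := by
    refine continuous_pi fun n => continuous_discrete_rng.2 fun e => isOpen_setOf_get_eq n e
  refine ⟨⟨le_antisymm (continuous_iff_le_induced.1 hc) ?_⟩, fun w w' h => ?_⟩
  · refine le_generateFrom ?_
    rintro _ ⟨x, rfl⟩
    refine ⟨{f | G.r (f 0) = x.r} ∩ ⋂ i : Fin x.edges.length, {f | f i = x.edges[i]}, ?_, ?_⟩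
    · refine IsOpen.inter ?_ (isOpen_iInter_of_finite fun i => ?_)
      · exact (isOpen_discrete {e | G.r e = x.r}).preimage
          (continuous_apply 0 : Continuous fun f : ℕ → E => f 0)
      · exact (isOpen_discrete {x.edges[i]}).preimage
          (continuous_apply (i : ℕ) : Continuous fun f : ℕ → E => f i)
    · rw [cylinder_eq]
      ext w
      simp only [mem_preimage, mem_inter_iff, mem_ofPred_eq, mem_iInter]
      exact and_congr Iff.rfl ⟨fun h i hi => h ⟨i, hi⟩, fun h i => h i i.2⟩
  · ext1
    exact Stream'.ext fun n => congrFun h n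

instance t2Space_infPath (G : DirectedGraph V E) : T2Space (InfPath G) := by
  let _ : TopologicalSpace E := ⊥
  have : DiscreteTopology E := ⟨rfl⟩
  exact isEmbedding_edges.t2Space

theorem continuous_degree : Continuous (fun a : Quiver.Total (InfPath G) => a.hom.1) := by
  refine continuous_discrete_rng.2 fun k => isOpen_iff_mem_nhds.2 ?_
  rintro a rfl
  obtain ⟨x, y, h, -⟩ := exists_mem_basicBisection a 0
  refine Filter.mem_of_superset ((isOpen_basicBisection x y).mem_nhds h) fun b hb => ?_
  exact hb.2.trans h.2.symm

/-- An arrow is determined by its two ends and its degree, all continuous with Hausdorff values. -/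
instance t2Space_total (G : DirectedGraph V E) : T2Space (Quiver.Total (InfPath G)) :=
  .of_injective_continuous
    (f := fun a : Quiver.Total (InfPath G) => (a.left, a.right, a.hom.1))
    (fun _ _ h => total_ext (congrArg (fun c => c.1) h) (congrArg (fun c => c.2.1) h)
      (congrArg (fun c => c.2.2) h))
    (continuous_left.prodMk (continuous_right.prodMk continuous_degree))

theorem finite_setOf_get (hfin : ∀ a : V, {e : E | G.r e = a}.Finite) (a : V) (n : ℕ) :
    {e : E | ∃ w : InfPath G, w.r = a ∧ w.edges.get n = e}.Finite := by
  induction n with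
  | zero =>
    refine (hfin a).subset ?_
    rintro _ ⟨w, hw, rfl⟩
    exact hw
  | succ n ih =>
    refine (ih.biUnion fun e _ => hfin (G.d e)).subset ?_
    rintro _ ⟨w, hw, rfl⟩
    exact mem_biUnion (x := w.edges.get n) ⟨w, hw, rfl⟩ (w.isPath n).symm

/-- From a fixed target only finitely many edges can occur at each position, so the cylinder is a
closed subset of a product of finite sets and Tychonoff applies. -/
theorem isCompact_cylinder (hfin : ∀ a : V, {e : E | G.r e = a}.Finite) (x : FinPath G) :
    IsCompact (cylinder x) := by
  let _ : TopologicalSpace E := ⊥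
  have : DiscreteTopology E := ⟨rfl⟩
  rw [(isEmbedding_edges (G := G)).isInducing.isCompact_iff]
  have hK : IsCompact (univ.pi fun n =>
      {e : E | ∃ w : InfPath G, w.r = x.r ∧ w.edges.get n = e}) :=
    isCompact_univ_pi fun n => (finite_setOf_get hfin x.r n).isCompact
  refine hK.of_isClosed_subset ?_ ?_
  · have : (fun (w : InfPath G) (n : ℕ) => w.edges.get n) '' cylinder x =
        (⋂ n, {f | G.d (f n) = G.r (f (n + 1))}) ∩
          ({f | G.r (f 0) = x.r} ∩ ⋂ i : Fin x.edges.length, {f | f i = x.edges[i]}) := by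
      rw [cylinder_eq]
      ext f
      simp only [mem_image, mem_inter_iff, mem_ofPred_eq, mem_iInter]
      constructor
      · rintro ⟨w, ⟨hr, hw⟩, rfl⟩
        exact ⟨w.isPath, hr, fun i => hw i i.2⟩
      · rintro ⟨hp, hr, hw⟩
        exact ⟨⟨f, hp⟩, ⟨hr, fun i hi => hw ⟨i, hi⟩⟩, rfl⟩
    rw [this]
    refine (isClosed_iInter fun n => ?_).inter (IsClosed.inter ?_ (isClosed_iInter fun i => ?_))
    · exact (isClosed_discrete {p : E × E | G.d p.1 = G.r p.2}).preimage
        ((continuous_apply n).prodMk (continuous_apply (n + 1)) :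
          Continuous fun f : ℕ → E => (f n, f (n + 1)))
    · exact (isClosed_discrete {e | G.r e = x.r}).preimage
          (continuous_apply 0 : Continuous fun f : ℕ → E => f 0)
    · exact (isClosed_discrete {x.edges[i]}).preimage
          (continuous_apply (i : ℕ) : Continuous fun f : ℕ → E => f i)
  · rintro _ ⟨w, hw, rfl⟩ n -
    rw [cylinder_eq] at hw
    exact ⟨w, hw.1, rfl⟩

theorem isCompact_basicBisection (hfin : ∀ a : V, {e : E | G.r e = a}.Finite) (x y : FinPath G) :
    IsCompact (basicBisection x y) := by
  by_cases h : x.d = y.d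
  · rw [isCompact_iff_isCompact_univ,
      (isOpenEmbedding_right_restrict x y).isInducing.isCompact_iff, image_univ, range_domRestrict,
      right_image_basicBisection h]
    exact isCompact_cylinder hfin y
  · rw [eq_empty_of_forall_notMem fun a (ha : a ∈ basicBisection x y) => h (basicBisection_d_eq ha)]
    exact isCompact_empty

/-! ### The ample semigroup is an inverse semigroup -/

section Ample

variable {C : Type u} [Groupoid.{v} C]

theorem mulArrow_assoc (a b c : Quiver.Total C) (h : a.right = b.left) (h' : b.right = c.left) :
    mulArrow (mulArrow a b h) c h' = mulArrow a (mulArrow b c h') h := by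
  simp [mulArrow]

theorem invArrow_invArrow (a : Quiver.Total C) : invArrow (invArrow a) = a := by
  simp [invArrow]

theorem mulArrow_invArrow_mulArrow (a : Quiver.Total C) (h : a.right = (invArrow a).left)
    (h' : (mulArrow a (invArrow a) h).right = a.left) :
    mulArrow (mulArrow a (invArrow a) h) a h' = a := by
  simp [mulArrow, invArrow]

theorem mulSet_assoc (A B D : Set (Quiver.Total C)) :
    mulSet (mulSet A B) D = mulSet A (mulSet B D) := by
  ext c
  constructor
  · rintro ⟨_, ⟨a, ha, b, hb, h, rfl⟩, d, hd, h', rfl⟩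
    exact ⟨a, ha, _, ⟨b, hb, d, hd, h', rfl⟩, h, mulArrow_assoc a b d h h'⟩
  · rintro ⟨a, ha, _, ⟨b, hb, d, hd, h', rfl⟩, h, rfl⟩
    exact ⟨_, ⟨a, ha, b, hb, h, rfl⟩, d, hd, h', (mulArrow_assoc a b d h h').symm⟩

/-- In a composable product `a b⁻¹ c` the arrows `a`, `b` share their right end and `b`, `c` their
left end, so all three are equal. -/
theorem IsBisection.mulSet_image_invArrow_mulSet {A : Set (Quiver.Total C)} (hA : IsBisection A) :
    mulSet (mulSet A (invArrow '' A)) A = A := by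
  ext a
  constructor
  · rintro ⟨_, ⟨a, ha, _, ⟨b, hb, rfl⟩, h, rfl⟩, c, hc, h', rfl⟩
    obtain rfl := hA.2 ha hb h
    obtain rfl := hA.1 ha hc h'
    rwa [mulArrow_invArrow_mulArrow]
  · intro ha
    exact ⟨_, ⟨a, ha, _, ⟨a, ha, rfl⟩, rfl, rfl⟩, a, ha, rfl,
      (mulArrow_invArrow_mulArrow a rfl rfl).symm⟩

theorem IsBisection.image_invArrow {A : Set (Quiver.Total C)} (hA : IsBisection A) :
    IsBisection (invArrow '' A) := by
  constructor
  · rintro _ ⟨a, ha, rfl⟩ _ ⟨b, hb, rfl⟩ h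
    rw [hA.2 ha hb h]
  · rintro _ ⟨a, ha, rfl⟩ _ ⟨b, hb, rfl⟩ h
    rw [hA.1 ha hb h]

theorem image_invArrow_image_invArrow (A : Set (Quiver.Total C)) :
    invArrow '' (invArrow '' A) = A := by
  simp [image_image, invArrow_invArrow]

theorem eq_invArrow_of_mulArrow_mulArrow {a b : Quiver.Total C} (h : a.right = b.left)
    (h' : b.right = a.left) (e : mulArrow (mulArrow a b h) a h' = a) : b = invArrow a := by
  obtain ⟨x, y, f⟩ := a
  obtain ⟨x', y', g⟩ := b
  dsimp at h h'
  subst h h'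
  have e : (f ≫ g) ≫ f = f := by simpa [mulArrow] using e
  have hg : g = Groupoid.inv f := by
    rw [← cancel_epi f, Groupoid.comp_inv, ← cancel_mono f, e, Category.id_comp]
  rw [hg]
  rfl

/-- Half of the uniqueness of inverses: in `a = a₁ b a₂` the ends force `a₁ = a = a₂`, and
cancelling leaves `b = a⁻¹`. -/
theorem IsBisection.image_invArrow_subset {A B : Set (Quiver.Total C)} (hA : IsBisection A)
    (h : mulSet (mulSet A B) A = A) : invArrow '' A ⊆ B := by
  rintro _ ⟨a, ha, rfl⟩
  obtain ⟨_, ⟨a₁, h₁, b, hb, e₁, rfl⟩, a₂, h₂, e₂, e⟩ := h.symm.subset ha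
  obtain rfl := hA.1 ha h₁ (congrArg (fun c => c.left) e)
  obtain rfl := hA.2 ha h₂ (congrArg (fun c => c.right) e)
  rwa [← eq_invArrow_of_mulArrow_mulArrow e₁ e₂ e.symm]

theorem isInverseSemigroup_ample [TopologicalSpace C] [TopologicalSpace (Quiver.Total C)]
    [EtaleGroupoid C] [T2Space (Quiver.Total C)] : IsInverseSemigroup (AmpleSemigroup C) := by
  have hc : Continuous (invArrow : Quiver.Total C → Quiver.Total C) :=
    TopologicalGroupoid.continuous_inv
  refine ⟨fun A B D => Subtype.ext (mulSet_assoc _ _ _), fun A => ?_⟩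
  have hbis := A.2.2.2.image_invArrow
  have hopen : IsOpen (invArrow '' A.1) := by
    rw [image_eq_preimage_of_inverse invArrow_invArrow invArrow_invArrow]
    exact A.2.2.1.preimage hc
  refine ⟨⟨invArrow '' A.1, A.2.1.image hc, hopen, hbis⟩, ⟨Subtype.ext ?_, Subtype.ext ?_⟩, ?_⟩
  · exact A.2.2.2.mulSet_image_invArrow_mulSet
  · have := hbis.mulSet_image_invArrow_mulSet
    rwa [image_invArrow_image_invArrow] at this
  · rintro B ⟨h₁, h₂⟩
    have h₁ := A.2.2.2.image_invArrow_subset (congrArg Subtype.val h₁)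
    have h₂ := image_mono (f := invArrow) (B.2.2.2.image_invArrow_subset (congrArg Subtype.val h₂))
    rw [image_invArrow_image_invArrow] at h₂
    exact Subtype.ext (h₂.antisymm h₁)

/-- Spares any check of associativity and inverses on representatives in `CK_G`. -/
theorem IsInverseSemigroup.of_mulEquiv {S T : Type*} [Mul S] [Mul T] (e : S ≃* T)
    (h : IsInverseSemigroup T) : IsInverseSemigroup S := by
  refine ⟨fun a b c => e.injective ?_, fun a => ?_⟩
  · simpa only [map_mul] using h.1 _ _ _
  · obtain ⟨b, ⟨h₁, h₂⟩, hu⟩ := h.2 (e a)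
    refine ⟨e.symm b, ⟨e.injective ?_, e.injective ?_⟩, fun c hc => ?_⟩
    · simpa using h₁
    · simpa using h₂
    · rw [← hu (e c) ⟨by rw [← map_mul, ← map_mul, hc.1], by rw [← map_mul, ← map_mul, hc.2]⟩,
        e.symm_apply_apply]

end Ample

/-! ### The union of the sets `Z(x, y)` over a set of fractions -/

/-- The union of the sets `Z(x, y)` over all non-zero elements `xy⁻¹` of `S`. -/
def realization (S : Set (GraphInvSemigroup G)) : Set (Quiver.Total (InfPath G)) :=
  {a | ∃ x y : FinPath G, Below S x y ∧ a ∈ basicBisection x y}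

theorem below_self {x y : FinPath G} (h : x.d = y.d) :
    Below {GraphInvSemigroup.frac x y h} x y :=
  GraphInvSemigroup.below_frac.2 ⟨FinPath.one G x.d, rfl, h.symm,
    (FinPath.comp_one x (a := x.d) rfl).symm, (FinPath.comp_one y (a := x.d) h.symm).symm⟩

theorem realization_zero : realization {(0 : GraphInvSemigroup G)} = ∅ :=
  eq_empty_of_forall_notMem fun _ ⟨_, _, h, _⟩ => GraphInvSemigroup.not_below_zero h

/-- Admitting all fractions below `xy⁻¹` adds nothing, because `Z(xp, yp) ⊆ Z(x, y)`. -/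
theorem realization_frac {x y : FinPath G} (h : x.d = y.d) :
    realization {GraphInvSemigroup.frac x y h} = basicBisection x y := by
  ext a
  constructor
  · rintro ⟨s, t, hb, ha⟩
    obtain ⟨p, h₁, h₂, rfl, rfl⟩ := GraphInvSemigroup.below_frac.1 hb
    exact basicBisection_comp_subset x y p h₁ h₂ ha
  · intro ha
    exact ⟨x, y, below_self h, ha⟩

theorem realization_eq_biUnion (S : Set (GraphInvSemigroup G)) :
    realization S = ⋃ s ∈ S, realization {s} := by
  ext a
  simp only [mem_iUnion]
  constructor
  · rintro ⟨x, y, hb, ha⟩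
    obtain ⟨s, hs, hb⟩ := below_set.1 hb
    exact ⟨s, hs, x, y, hb, ha⟩
  · rintro ⟨s, hs, x, y, hb, ha⟩
    exact ⟨x, y, below_set.2 ⟨s, hs, hb⟩, ha⟩

theorem isOpen_realization (S : Set (GraphInvSemigroup G)) : IsOpen (realization S) := by
  rw [isOpen_iff_mem_nhds]
  rintro a ⟨x, y, hb, ha⟩
  exact Filter.mem_of_superset ((isOpen_basicBisection x y).mem_nhds ha)
    fun b hb' => ⟨x, y, hb, hb'⟩

theorem isCompact_realization (hfin : ∀ a : V, {e : E | G.r e = a}.Finite)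
    {S : Set (GraphInvSemigroup G)} (hS : S.Finite) : IsCompact (realization S) := by
  rw [realization_eq_biUnion]
  refine hS.isCompact_biUnion fun s _ => ?_
  cases s with
  | zero => exact realization_zero (G := G) ▸ isCompact_empty
  | frac x y h => exact realization_frac h ▸ isCompact_basicBisection hfin x y

/-- By orthogonality, in a fraction below `A` either path determines the other. For two arrows with
a common end, the paths at that end are comparable prefixes; lengthening the shorter pair makes them
equal, and the other paths follow. -/
theorem isBisection_realization (A : OrthCompletion G) : IsBisection (realization A.carrier) := by
  have key : ∀ {a b c : FinPath G}, Below A.carrier a b → Below A.carrier a c → b = c := by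
    intro a b c h h'
    obtain ⟨s, hs, h⟩ := below_set.1 h
    obtain ⟨t, ht, h'⟩ := below_set.1 h'
    obtain rfl : s = t := by
      by_contra hne
      exact (orthogonal_iff.1 (A.orthogonal s hs t ht hne)).1 _ _ _ h h'
    exact GraphInvSemigroup.below_right_unique h h'
  have key' : ∀ {a b c : FinPath G}, Below A.carrier b a → Below A.carrier c a → b = c := by
    intro a b c h h'
    obtain ⟨s, hs, h⟩ := below_set.1 h
    obtain ⟨t, ht, h'⟩ := below_set.1 h'
    obtain rfl : s = t := by
      by_contra hne
      exact (orthogonal_iff.1 (A.orthogonal s hs t ht hne)).2 _ _ _ h h'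
    exact GraphInvSemigroup.below_right_unique (GraphInvSemigroup.below_inv.2 h)
      (GraphInvSemigroup.below_inv.2 h')
  constructor
  · rintro a ⟨x, y, h, ha⟩ b ⟨s, t, h', hb⟩ e
    obtain ⟨w, hx, hy, rfl⟩ := mem_basicBisection.1 ha
    obtain ⟨w', hs, ht, rfl⟩ := mem_basicBisection.1 hb
    rcases FinPath.prepend_comparable (h := hx) (h' := hs) e with
      ⟨z, hz, hz', rfl, rfl⟩ | ⟨z, hz, hz', rfl, rfl⟩
    · have hyz : y.d = z.r := hy.trans (z.prepend_r _ _)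
      obtain rfl := key h' (below_comp h hz hyz)
      exact (arrow_comp x y z w' hz hyz hz').symm
    · have htz : t.d = z.r := ht.trans (z.prepend_r _ _)
      obtain rfl := key h (below_comp h' hz htz)
      exact arrow_comp s t z w hz htz hz'
  · rintro a ⟨x, y, h, ha⟩ b ⟨s, t, h', hb⟩ e
    obtain ⟨w, hx, hy, rfl⟩ := mem_basicBisection.1 ha
    obtain ⟨w', hs, ht, rfl⟩ := mem_basicBisection.1 hb
    rcases FinPath.prepend_comparable (h := hy) (h' := ht) e with
      ⟨z, hz, hz', rfl, rfl⟩ | ⟨z, hz, hz', rfl, rfl⟩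
    · have hxz : x.d = z.r := hx.trans (z.prepend_r _ _)
      obtain rfl := key' h' (below_comp h hxz hz)
      exact (arrow_comp x y z w' hxz hz hz').symm
    · have hsz : s.d = z.r := hs.trans (z.prepend_r _ _)
      obtain rfl := key' h (below_comp h' hsz hz)
      exact arrow_comp s t z w hsz hz hz'

/-- For composable arrows from `Z(x, y)` and `Z(s, t)`, the paths `y` and `s` are prefixes of the
middle infinite path. Lengthening the shorter pair makes them equal, and `below_set_mul` applies. -/
theorem realization_mul (A B : OrthCompletion G) :
    realization (A * B).carrier = mulSet (realization A.carrier) (realization B.carrier) := by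
  ext c
  constructor
  · rintro ⟨x, z, h, hc⟩
    obtain ⟨y, h₁, h₂⟩ := below_set_mul.1 h
    obtain ⟨w, hx, hz, rfl⟩ := mem_basicBisection.1 hc
    have hxy : x.d = y.d := by
      obtain ⟨_, _, h, _⟩ := h₁
      exact h
    have hy : y.d = w.r := hxy.symm.trans hx
    exact ⟨arrow x y w hx hy, ⟨x, y, h₁, arrow_mem _ _ _ _ _⟩, arrow y z w hy hz,
      ⟨y, z, h₂, arrow_mem _ _ _ _ _⟩, rfl, (mulArrow_arrow x y z w hx hy hz rfl).symm⟩
  · rintro ⟨a, ⟨x, y, h₁, ha⟩, b, ⟨s, t, h₂, hb⟩, h, rfl⟩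
    obtain ⟨w, hx, hy, rfl⟩ := mem_basicBisection.1 ha
    obtain ⟨w', hs, ht, rfl⟩ := mem_basicBisection.1 hb
    rcases FinPath.prepend_comparable (h := hy) (h' := hs) h with
      ⟨z, hz, hz', rfl, rfl⟩ | ⟨z, hz, hz', rfl, rfl⟩
    · have hxz : x.d = z.r := hx.trans (z.prepend_r _ _)
      refine ⟨_, _, below_set_mul.2 ⟨_, below_comp h₁ hxz hz, h₂⟩,
        mulArrow_mem_basicBisection ?_ hb h⟩
      rw [← arrow_comp x y z w' hxz hz hz']
      exact arrow_mem _ _ _ _ _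
    · have htz : t.d = z.r := ht.trans (z.prepend_r _ _)
      refine ⟨_, _, below_set_mul.2 ⟨_, h₁, below_comp h₂ hz htz⟩,
        mulArrow_mem_basicBisection ha ?_ h⟩
      rw [← arrow_comp s t z w hz htz hz']
      exact arrow_mem _ _ _ _ _

/-! ### Lenz equivalence as equality of realizations -/

theorem basicBisection_nonempty (hne : ∀ a : V, ∃ e : E, G.r e = a) {x y : FinPath G}
    (h : x.d = y.d) : (basicBisection x y).Nonempty := by
  obtain ⟨w, hw⟩ := exists_infPath_r_eq hne x.d
  exact ⟨_, arrow_mem x y w hw.symm (h.symm.trans hw.symm)⟩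

theorem Below.d_eq {S : Set (GraphInvSemigroup G)} {x y : FinPath G} (h : Below S x y) :
    x.d = y.d := by
  obtain ⟨_, _, h, _⟩ := h
  exact h

/-- The Lenz arrow relation between sets is the inclusion of the sets of arrows. -/
theorem lenzArrow_iff_realization_subset (hfin : ∀ a : V, {e : E | G.r e = a}.Finite)
    (hne : ∀ a : V, ∃ e : E, G.r e = a) {S T : Set (GraphInvSemigroup G)} (hT : T.Finite) :
    (∀ s ∈ S, LenzArrow s T) ↔ realization S ⊆ realization T := by
  rw [lenzArrow_iff]
  constructor
  · rintro H a ⟨x, y, h, ha⟩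
    -- The target is closed, so it suffices that every basic neighbourhood of `a` meets it.
    rw [← (isCompact_realization hfin hT).isClosed.closure_eq,
      (isTopologicalBasis_basicBisection G).mem_closure_iff]
    rintro _ ⟨s, t, rfl⟩ ha'
    obtain ⟨w, hx, hy, rfl⟩ := mem_basicBisection.1 ha
    -- Lengthening by `|s|` puts `Z(xz, yz)` inside the neighbourhood `Z(s, t)`; the arrow relation
    -- then yields a smaller non-empty set belonging to `T`.
    obtain ⟨z, hxz, hyz, hz, hl⟩ := exists_arrow_comp x y w hx hy s.length
    obtain ⟨p, h₁, h₂, hp⟩ := H _ _ (below_comp h hxz hyz)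
    obtain ⟨b, hb⟩ := basicBisection_nonempty hne hp.d_eq
    exact ⟨b, basicBisection_subset_of_mem ha' hz (by rw [FinPath.length_comp]; omega)
      (basicBisection_comp_subset _ _ _ _ _ hb), _, _, hp, hb⟩
  · intro H x y h
    obtain ⟨a, ha⟩ := basicBisection_nonempty hne h.d_eq
    obtain ⟨s, t, h', ha'⟩ := H ⟨x, y, h, ha⟩
    -- The two sets share an arrow and are nested: either `st⁻¹` is already the wanted fraction
    -- below `xy⁻¹`, or `xy⁻¹` itself lies below `T` and the empty path will do.
    rcases le_total x.length s.length with hl | hl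
    · obtain ⟨z, hx, hy, rfl, rfl⟩ := exists_comp_of_mem ha ha' hl
      exact ⟨z, hx, hy, h'⟩
    · obtain ⟨z, hs, ht, rfl, rfl⟩ := exists_comp_of_mem ha' ha hl
      refine ⟨FinPath.one G (s.comp z hs).d, rfl, h.d_eq.symm, ?_⟩
      rw [FinPath.comp_one _ (a := (s.comp z hs).d) rfl,
        FinPath.comp_one _ (a := (s.comp z hs).d) h.d_eq.symm]
      exact below_comp h' hs ht

theorem lenzEquiv_iff_realization_eq (hfin : ∀ a : V, {e : E | G.r e = a}.Finite)
    (hne : ∀ a : V, ∃ e : E, G.r e = a) {A B : OrthCompletion G} :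
    LenzEquiv A.carrier B.carrier ↔ realization A.carrier = realization B.carrier := by
  rw [LenzEquiv, lenzArrow_iff_realization_subset hfin hne B.finite,
    lenzArrow_iff_realization_subset hfin hne A.finite, Subset.antisymm_iff]

/-! ### Every compact-open bisection is a realization -/

/-- If fractions below `s` and `t` shared a path `a` on the same side, then arrows of the two
realizations would share the end `aw`; in a bisection they would be equal, against disjointness. -/
theorem orthogonal_of_isBisection (hne : ∀ a : V, ∃ e : E, G.r e = a)
    {s t : GraphInvSemigroup G} {A : Set (Quiver.Total (InfPath G))} (hA : IsBisection A)
    (hs : realization {s} ⊆ A) (ht : realization {t} ⊆ A)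
    (hd : Disjoint (realization {s}) (realization {t})) : Orthogonal s t := by
  rw [orthogonal_iff]
  constructor
  · intro a b c hb hc
    obtain ⟨w, hw⟩ := exists_infPath_r_eq hne a.d
    have h₁ : arrow a b w hw.symm (hb.d_eq.symm.trans hw.symm) ∈ realization {s} :=
      ⟨a, b, hb, arrow_mem _ _ _ _ _⟩
    have h₂ : arrow a c w hw.symm (hc.d_eq.symm.trans hw.symm) ∈ realization {t} :=
      ⟨a, c, hc, arrow_mem _ _ _ _ _⟩
    have e := hA.1 (hs h₁) (ht h₂) rfl
    exact disjoint_left.1 hd h₁ (e ▸ h₂)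
  · intro a b c hb hc
    obtain ⟨w, hw⟩ := exists_infPath_r_eq hne a.d
    have h₁ : arrow b a w (hb.d_eq.trans hw.symm) hw.symm ∈ realization {s} :=
      ⟨b, a, hb, arrow_mem _ _ _ _ _⟩
    have h₂ : arrow c a w (hc.d_eq.trans hw.symm) hw.symm ∈ realization {t} :=
      ⟨c, a, hc, arrow_mem _ _ _ _ _⟩
    have e := hA.2 (hs h₁) (ht h₂) rfl
    exact disjoint_left.1 hd h₁ (e ▸ h₂)

/-- A compact open set of arrows is the disjoint union of finitely many sets `Z(x, y)`. -/
theorem exists_finite_disjoint (hfin : ∀ a : V, {e : E | G.r e = a}.Finite)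
    {A : Set (Quiver.Total (InfPath G))} (hc : IsCompact A) (ho : IsOpen A) :
    ∃ T : Set (FinPath G × FinPath G), T.Finite ∧ A = ⋃ p ∈ T, basicBisection p.1 p.2 ∧
      ∀ p ∈ T, ∀ q ∈ T, p ≠ q → Disjoint (basicBisection p.1 p.2) (basicBisection q.1 q.2) := by
  have hbasis : TopologicalSpace.IsTopologicalBasis
      (range fun p : FinPath G × FinPath G => basicBisection p.1 p.2) := by
    convert isTopologicalBasis_basicBisection G using 1
    ext A
    exact ⟨fun ⟨p, hp⟩ => ⟨p.1, p.2, hp.symm⟩, fun ⟨x, y, h⟩ => ⟨(x, y), h.symm⟩⟩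
  obtain ⟨T, hT, rfl⟩ := (isCompact_open_iff_eq_finite_iUnion_of_isTopologicalBasis _ hbasis
    (fun p => isCompact_basicBisection hfin p.1 p.2) A).1 ⟨hc, ho⟩
  -- Keep the pairs whose first path is shortest among all pairs of `T` whose sets meet theirs. Two
  -- kept sets that meet have first paths of equal length, so their pairs coincide.
  refine ⟨{p ∈ T | ∀ q ∈ T, (basicBisection p.1 p.2 ∩ basicBisection q.1 q.2).Nonempty →
    p.1.length ≤ q.1.length}, hT.subset (sep_subset _ _), ?_, ?_⟩
  · refine Subset.antisymm (iUnion₂_subset fun p hp a ha => ?_)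
      (biUnion_subset_biUnion_left (sep_subset _ _))
    -- A shortest pair whose set contains `a` is kept: a set meeting it with a shorter first path
    -- would contain it, hence contain `a`.
    obtain ⟨q, ⟨hq, haq⟩, hmin⟩ := exists_minimalFor_of_wellFoundedLT
      (fun q : FinPath G × FinPath G => q ∈ T ∧ a ∈ basicBisection q.1 q.2)
      (fun q => q.1.length) ⟨p, hp, ha⟩
    refine mem_biUnion (x := q) ⟨hq, fun q' hq' ⟨b, hb, hb'⟩ => ?_⟩ haq
    rcases le_total q.1.length q'.1.length with hl | hl
    · exact hl
    · exact hmin ⟨hq', basicBisection_subset_of_mem hb' hb hl haq⟩ hl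
  · rintro p ⟨hp, hp'⟩ q ⟨hq, hq'⟩ hne
    refine disjoint_left.2 fun a ha hb => hne ?_
    obtain ⟨h₁, h₂⟩ := eq_of_mem_basicBisection ha hb
      (le_antisymm (hp' q hq ⟨a, ha, hb⟩) (hq' p hp ⟨a, hb, ha⟩))
    exact Prod.ext h₁.symm h₂.symm

theorem exists_realization_eq (hfin : ∀ a : V, {e : E | G.r e = a}.Finite)
    (hne : ∀ a : V, ∃ e : E, G.r e = a) {A : Set (Quiver.Total (InfPath G))}
    (hc : IsCompact A) (ho : IsOpen A) (hA : IsBisection A) :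
    ∃ B : OrthCompletion G, realization B.carrier = A := by
  obtain ⟨T, hT, rfl, hd⟩ := exists_finite_disjoint hfin hc ho
  -- Pairs with different sources give no fraction, but their sets `Z(x, y)` are empty and may be
  -- dropped.
  set S : Set (GraphInvSemigroup G) :=
    insert 0 {s | ∃ p ∈ T, ∃ h : p.1.d = p.2.d, s = .frac p.1 p.2 h} with hS
  have hsub : ∀ s ∈ S, realization {s} ⊆ ⋃ p ∈ T, basicBisection p.1 p.2 := by
    rintro s (rfl | ⟨p, hp, h, rfl⟩)
    · rw [realization_zero]
      exact empty_subset _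
    · rw [realization_frac]
      exact subset_biUnion_of_mem (u := fun p : FinPath G × FinPath G => basicBisection p.1 p.2) hp
  refine ⟨⟨S, ?_, mem_insert _ _, ?_⟩, ?_⟩
  · classical
    refine (Finite.subset (hT.image fun p : FinPath G × FinPath G =>
      if h : p.1.d = p.2.d then GraphInvSemigroup.frac p.1 p.2 h else 0) ?_).insert 0
    rintro _ ⟨p, hp, h, rfl⟩
    exact ⟨p, hp, dif_pos h⟩
  · intro s hs t ht hst
    refine orthogonal_of_isBisection hne hA (hsub s hs) (hsub t ht) ?_
    rcases hs with rfl | ⟨p, hp, h, rfl⟩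
    · rw [realization_zero]
      exact empty_disjoint _
    rcases ht with rfl | ⟨q, hq, h', rfl⟩
    · rw [realization_zero]
      exact disjoint_empty _
    rw [realization_frac, realization_frac]
    refine hd p hp q hq ?_
    rintro rfl
    exact hst rfl
  · change realization S = _
    rw [realization_eq_biUnion]
    refine Subset.antisymm (iUnion₂_subset hsub) (iUnion₂_subset fun p hp a ha => ?_)
    have h := basicBisection_d_eq ha
    refine mem_biUnion (x := GraphInvSemigroup.frac p.1 p.2 h) (Or.inr ⟨p, hp, h, rfl⟩) ?_
    rwa [realization_frac]

theorem realization_iota_frac {x y : FinPath G} (h : x.d = y.d) :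
    realization (iota (.frac x y h)).carrier = basicBisection x y := by
  rw [realization_eq_biUnion, iota, biUnion_insert, biUnion_singleton, realization_zero,
    empty_union, realization_frac]

/-- The isomorphism from the Cuntz–Krieger semigroup onto the ample semigroup. -/
noncomputable def cuntzKriegerEquivAmple (hfin : ∀ a : V, {e : E | G.r e = a}.Finite)
    (hne : ∀ a : V, ∃ e : E, G.r e = a) :
    CuntzKrieger G ≃* AmpleSemigroup (InfPath G) :=
  MulEquiv.ofBijective
    (⟨Quotient.lift (fun A => ⟨realization A.carrier, isCompact_realization hfin A.finite,
          isOpen_realization _, isBisection_realization A⟩)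
        fun _ _ h => Subtype.ext ((lenzEquiv_iff_realization_eq hfin hne).1 h),
      fun a b => Quotient.inductionOn₂ a b fun A B => Subtype.ext (realization_mul A B)⟩ :
      CuntzKrieger G →ₙ* AmpleSemigroup (InfPath G))
    ⟨fun a b => Quotient.inductionOn₂ a b fun _ _ h => Quotient.sound
        ((lenzEquiv_iff_realization_eq hfin hne).2 (congrArg Subtype.val h)),
      fun A => by
        obtain ⟨B, hB⟩ := exists_realization_eq hfin hne A.2.1 A.2.2.1 A.2.2.2
        exact ⟨Quotient.mk _ B, Subtype.ext hB⟩⟩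

end GraphCK

theorem theorem3p20 {V : Type*} {E : Type*} (G : GraphCK.DirectedGraph V E)
    (hfin : ∀ w : V, {e : E | G.r e = w}.Finite)
    (htwo : ∀ w : V, 2 ≤ {e : E | G.r e = w}.ncard) :
    TopologicalSpace.IsTopologicalBasis
      {A | ∃ x y : GraphCK.FinPath G, A = GraphCK.basicBisection x y} ∧
    ∃ (_ : GraphCK.EtaleGroupoid (GraphCK.InfPath G))
      (_ : T2Space (Quiver.Total (GraphCK.InfPath G))),
      GraphCK.IsInverseSemigroup (GraphCK.CuntzKrieger G) ∧
      GraphCK.IsInverseSemigroup (GraphCK.AmpleSemigroup (GraphCK.InfPath G)) ∧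
      ∃ φ : GraphCK.CuntzKrieger G ≃* GraphCK.AmpleSemigroup (GraphCK.InfPath G),
        ∀ (x y : GraphCK.FinPath G) (h : x.d = y.d),
          (φ (GraphCK.delta (GraphCK.GraphInvSemigroup.frac x y h))).1 =
            GraphCK.basicBisection x y := by
  have hne : ∀ a : V, ∃ e : E, G.r e = a := fun a =>
    nonempty_of_ncard_ne_zero (s := {e : E | G.r e = a}) (by have := htwo a; omega)
  refine ⟨GraphCK.isTopologicalBasis_basicBisection G, inferInstance, inferInstance,
    .of_mulEquiv (GraphCK.cuntzKriegerEquivAmple hfin hne) GraphCK.isInverseSemigroup_ample,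
    GraphCK.isInverseSemigroup_ample, GraphCK.cuntzKriegerEquivAmple hfin hne, fun x y h => ?_⟩
  -- The isomorphism is evaluated at the representative `{0, xy⁻¹}`, whose zero contributes no
  -- arrows.
  exact GraphCK.realization_iota_frac h
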